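/- **Setting.** Let $N,M\in\mathbb N$, $U=(u_{i,j})\in\mathbb R^{N\times M}$, and let $f_i:\mathbb R^{n_i}\to\mathbb R$ $(i\le N)$, $g_j:\mathbb R^{m_j}\to\mathbb R$ $(j\le M)$ be $C^r$ functions with $2\le r\le\infty$. Let $(p,q)$ be a fully mixed Nash equilibrium of the zero-sum game $\min_{x\in\Delta_N}\max_{y\in\Delta_M}x^\top Uy$ (all $p_i,q_j>0$). Consider the constrained gradient-descent-ascent system $$\dot\theta_i=-\nabla f_i(\theta_i)\Big(\sum_j u_{i,j}g_j(\phi_j)+\lambda\Big),\qquad \dot\phi_j=\nabla g_j(\phi_j)\Big(\sum_i u_{i,j}f_i(\theta_i)+\mu\Big),$$ $$\dot\lambda=\sum_i f_i(\theta_i)-1,\qquad \dot\mu=-\Big(\sum_j g_j(\phi_j)-1\Big).\qquad(\ast)$$ For a function $k$ and a point $x_0$, let $k_{x_0}$ be the set of values of $k$ along the gradient ascent curve $\dot x=\nabla k(x)$, $x(0)=x_0$ (in forward and backward time). Let $X_{x_0}(z)$, for $z\in k_{x_0}$, be the point of this curve at which $k=z$ (it is unique if $\nabla k(x_0)\neq0$).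 Let $(\theta(0),\phi(0),\lambda(0),\mu(0))$ be a *safe* initialization: $\nabla f_i(\theta_i(0))\ne0$, $\nabla g_j(\phi_j(0))\neq 0$, $p_i\in (f_i)_{\theta_i(0)}$ and $q_j\in (g_j)_{\phi_j(0)}$ for all $i,j$. Assume that the gradient ascent curves of $f_i$ from $\theta_i(0)$ and of $g_j$ from $\phi_j(0)$ exist for all $t\in\mathbb R$. **Theorem.** The functions $$\mathcal A_i(y)=\int_{p_i}^{y}\frac{dz}{\|\nabla f_i(X_{\theta_i(0)}(z))\|^2},\qquad \mathcal B_j(y)=\int_{q_j}^{y}\frac{dz}{\|\nabla g_j(X_{\phi_j(0)}(z))\|^2}$$ are $C^r$ diffeomorphisms of $(f_i)_{\theta_i(0)}$, respectively $(g_j)_{\phi_j(0)}$, onto $\mathbb R$. The vector field on $\mathbb R^{N+M+2}$ of the system $$\dot a_i=-\Big(\sum_j u_{i,j}\mathcal B_j^{-1}(b_j)+\lambda\Big),\quad \dot b_j=\sum_i u_{i,j}\mathcal A_i^{-1}(a_i)+\mu,\quad \dot\lambda=\sum_i\mathcal A_i^{-1}(a_i)-1,\quad \dot\mu=-\Big(\sum_j\mathcal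 B_j^{-1}(b_j)-1\Big)$$ is $C^r$ and divergence free, and it generates a flow $\Psi$ on $\mathbb R^{N+M+2}$, defined for all times, all of whose orbits are bounded and which is Poincaré recurrent: for Lebesgue-almost every point $x$, every neighbourhood of $x$ contains $\Psi(x,t_k)$ for all $k$, for some increasing sequence $t_k\to\infty$. The solution $z(t)=(\theta(t),\phi(t),\lambda(t),\mu(t))$ of $(\ast)$ with the given initialization exists for all $t\in\mathbb R$ and is unique. The map $$D(\theta,\phi,\lambda,\mu)=\big((\mathcal A_i(f_i(\theta_i)))_i,(\mathcal B_j(g_j(\phi_j)))_j,\lambda,\mu\big)$$ satisfies $D(z(t))=\Psi(D(z(0)),t)$ for all $t$, and restricts to a $C^r$ diffeomorphism of the trajectory $\{z(t)\}$ onto the trajectory $\{\Psi(D(z(0)),t)\}$: it is a bijection between the two sets, and it and its inverse extend to $C^r$ maps on open neighbourhoods of them. -/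

import Mathlib

open Set Filter Topology MeasureTheory

noncomputable section

namespace HiddenGame

/-! ### Gradient ascent curves and the induced reparametrization -/

section Gradient

variable {d : ℕ}

/-- The points visited by the (maximal) solution of `γ' = ∇k(γ)`, `γ(0) = x₀`, in forward and
backward time: the union of the images of all solutions on open intervals around `0`. -/
def gradientOrbit (k : EuclideanSpace ℝ (Fin d) → ℝ) (x₀ : EuclideanSpace ℝ (Fin d)) :
    Set (EuclideanSpace ℝ (Fin d)) :=
  {x | ∃ (γ : ℝ → EuclideanSpace ℝ (Fin d)) (a b t : ℝ), a < 0 ∧ 0 < b ∧ γ 0 = x₀ ∧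
    (∀ s ∈ Ioo a b, HasDerivAt γ (gradient k (γ s)) s) ∧ t ∈ Ioo a b ∧ γ t = x}

/-- The solution of `γ' = ∇k(γ)`, `γ(0) = x₀` exists for all times. -/
def GradientComplete (k : EuclideanSpace ℝ (Fin d) → ℝ) (x₀ : EuclideanSpace ℝ (Fin d)) : Prop :=
  ∃ γ : ℝ → EuclideanSpace ℝ (Fin d), γ 0 = x₀ ∧ ∀ s, HasDerivAt γ (gradient k (γ s)) s

/-- The set of values that `k` attains along gradient ascent started at `x₀`. -/
def attainable (k : EuclideanSpace ℝ (Fin d) → ℝ) (x₀ : EuclideanSpace ℝ (Fin d)) : Set ℝ :=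
  k '' gradientOrbit k x₀

/-- The map `X_{x₀}` sending an attainable value `y` to the point of the gradient ascent curve
through `x₀` at which `k` takes the value `y`. -/
def orbitPoint (k : EuclideanSpace ℝ (Fin d) → ℝ) (x₀ : EuclideanSpace ℝ (Fin d)) :
    ℝ → EuclideanSpace ℝ (Fin d) :=
  Function.invFunOn k (gradientOrbit k x₀)

/-- The new coordinate `∫_p^y dz / ‖∇k(X_{x₀}(z))‖²` of an attainable value `y`. -/
def reparam (k : EuclideanSpace ℝ (Fin d) → ℝ) (x₀ : EuclideanSpace ℝ (Fin d)) (p y : ℝ) : ℝ :=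
  ∫ z in p..y, 1 / ‖gradient k (orbitPoint k x₀ z)‖ ^ 2

/-- The inverse of `reparam`: the attainable value with a given new coordinate. -/
def reparamInv (k : EuclideanSpace ℝ (Fin d) → ℝ) (x₀ : EuclideanSpace ℝ (Fin d)) (p : ℝ) :
    ℝ → ℝ :=
  Function.invFunOn (reparam k x₀ p) (attainable k x₀)

end Gradient

/-! ### Diffeomorphisms between subsets, flows, recurrence, divergence -/

section Dynamics

/-- `D` restricts to a `C^r` diffeomorphism from the subset `S` onto the subset `T`: it is a
bijection `S → T`, it is `C^r` on an open neighbourhood of `S`, and its inverse extends to a map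
that is `C^r` on an open neighbourhood of `T`. -/
def IsDiffeoBetween {E F : Type*} [NormedAddCommGroup E] [NormedSpace ℝ E]
    [NormedAddCommGroup F] [NormedSpace ℝ F] (r : ℕ∞) (D : E → F) (S : Set E) (T : Set F) : Prop :=
  MapsTo D S T ∧ (∃ W, IsOpen W ∧ S ⊆ W ∧ ContDiffOn ℝ r D W) ∧
  ∃ D' : F → E, MapsTo D' T S ∧ InvOn D' D S T ∧
    ∃ W', IsOpen W' ∧ T ⊆ W' ∧ ContDiffOn ℝ r D' W'

/-- `z` is a solution, defined for all times, of the autonomous system `z' = V(z)`. -/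
def IsTrajectory {E : Type*} [NormedAddCommGroup E] [NormedSpace ℝ E] (V : E → E) (z : ℝ → E) :
    Prop :=
  ∀ t, HasDerivAt z (V (z t)) t

/-- The divergence (trace of the Jacobian) of a vector field. -/
def divergence {E : Type*} [NormedAddCommGroup E] [NormedSpace ℝ E] (V : E → E) (x : E) : ℝ :=
  LinearMap.trace ℝ E (fderiv ℝ V x : E →ₗ[ℝ] E)

/-- The point `x` is recurrent under the flow `Ψ`. -/
def IsRecurrentPoint {E : Type*} [TopologicalSpace E] (Ψ : Flow ℝ E) (x : E) : Prop :=
  ∀ O ∈ 𝓝 x, ∃ t : ℕ → ℝ, StrictMono t ∧ Tendsto t atTop atTop ∧ ∀ k, Ψ (t k) x ∈ O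

/-- The flow `Ψ` is Poincaré recurrent in the set `A` of nonzero measure. -/
def IsPoincareRecurrentOn {E : Type*} [TopologicalSpace E] [MeasureSpace E] (Ψ : Flow ℝ E)
    (A : Set E) : Prop :=
  volume A ≠ 0 ∧ volume {x ∈ A | ¬ IsRecurrentPoint Ψ x} = 0

end Dynamics

/-! ### The hidden bilinear game -/

/-- `(p, q)` is a fully mixed Nash equilibrium of the zero-sum game with payoff `xᵀ U y`, where
`x` minimizes and `y` maximizes over the probability simplices. -/
structure IsFullyMixedNash {N M : ℕ} (U : Matrix (Fin N) (Fin M) ℝ) (p : Fin N → ℝ)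
    (q : Fin M → ℝ) : Prop where
  p_mem : p ∈ stdSimplex ℝ (Fin N)
  q_mem : q ∈ stdSimplex ℝ (Fin M)
  p_pos : ∀ i, 0 < p i
  q_pos : ∀ j, 0 < q j
  p_opt : ∀ x ∈ stdSimplex ℝ (Fin N), p ⬝ᵥ U.mulVec q ≤ x ⬝ᵥ U.mulVec q
  q_opt : ∀ y ∈ stdSimplex ℝ (Fin M), p ⬝ᵥ U.mulVec y ≤ p ⬝ᵥ U.mulVec q

/-- The states `(θ, φ, λ, μ)`, with blocks `θ_i ∈ ℝ^{n_i}` and `φ_j ∈ ℝ^{m_j}`. -/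
abbrev State {N M : ℕ} (n : Fin N → ℕ) (m : Fin M → ℕ) : Type :=
  (∀ i, EuclideanSpace ℝ (Fin (n i))) × (∀ j, EuclideanSpace ℝ (Fin (m j))) × ℝ × ℝ

/-- The reduced states `(a, b, λ, μ) ∈ ℝ^N × ℝ^M × ℝ × ℝ`. -/
abbrev Reduced (N M : ℕ) : Type := (Fin N → ℝ) × (Fin M → ℝ) × ℝ × ℝ

section Game

variable {N M : ℕ} {n : Fin N → ℕ} {m : Fin M → ℕ}

/-- The vector field of constrained gradient-descent-ascent. -/
def gdaField (f : ∀ i, EuclideanSpace ℝ (Fin (n i)) → ℝ)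
    (g : ∀ j, EuclideanSpace ℝ (Fin (m j)) → ℝ) (U : Matrix (Fin N) (Fin M) ℝ) :
    State n m → State n m :=
  fun (θ, φ, lam, mu) =>
    (fun i => -(∑ j, U i j * g j (φ j) + lam) • gradient (f i) (θ i),
     fun j => (∑ i, U i j * f i (θ i) + mu) • gradient (g j) (φ j),
     ∑ i, f i (θ i) - 1,
     -(∑ j, g j (φ j) - 1))

/-- Safe initializations (no condition on the multipliers). -/
structure IsSafe (f : ∀ i, EuclideanSpace ℝ (Fin (n i)) → ℝ)
    (g : ∀ j, EuclideanSpace ℝ (Fin (m j)) → ℝ) (p : Fin N → ℝ) (q : Fin M → ℝ)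
    (x₀ : State n m) : Prop where
  θ_nonstationary : ∀ i, gradient (f i) (x₀.1 i) ≠ 0
  φ_nonstationary : ∀ j, gradient (g j) (x₀.2.1 j) ≠ 0
  p_attainable : ∀ i, p i ∈ attainable (f i) (x₀.1 i)
  q_attainable : ∀ j, q j ∈ attainable (g j) (x₀.2.1 j)

/-- The reduced vector field: `a_i` and `b_j` are the new coordinates of the values of `f_i` and
`g_j` attainable from the initialization `x₀`. -/
def reducedField (f : ∀ i, EuclideanSpace ℝ (Fin (n i)) → ℝ)
    (g : ∀ j, EuclideanSpace ℝ (Fin (m j)) → ℝ) (U : Matrix (Fin N) (Fin M) ℝ)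
    (p : Fin N → ℝ) (q : Fin M → ℝ) (x₀ : State n m) : Reduced N M → Reduced N M :=
  fun (a, b, lam, mu) =>
    (fun i => -(∑ j, U i j * reparamInv (g j) (x₀.2.1 j) (q j) (b j) + lam),
     fun j => ∑ i, U i j * reparamInv (f i) (x₀.1 i) (p i) (a i) + mu,
     ∑ i, reparamInv (f i) (x₀.1 i) (p i) (a i) - 1,
     -(∑ j, reparamInv (g j) (x₀.2.1 j) (q j) (b j) - 1))

/-- The change of variables from states to reduced states. -/
def reduction (f : ∀ i, EuclideanSpace ℝ (Fin (n i)) → ℝ)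
    (g : ∀ j, EuclideanSpace ℝ (Fin (m j)) → ℝ)
    (p : Fin N → ℝ) (q : Fin M → ℝ) (x₀ : State n m) : State n m → Reduced N M :=
  fun (θ, φ, lam, mu) =>
    (fun i => reparam (f i) (x₀.1 i) (p i) (f i (θ i)),
     fun j => reparam (g j) (x₀.2.1 j) (q j) (g j (φ j)),
     lam, mu)

end Game

end HiddenGame

end

/-!
The reduced field is a separable Hamiltonian system in disguise, and the gradient-descent-ascent
trajectory is its lift along the gradient ascent curves.

*Change of variables.* Along a gradient ascent curve `γ' = ∇k(γ)` the value of `k` grows with speed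
`‖∇k‖² > 0`, so the integral of `1 / ‖∇k‖²` over the attained values is elapsed time. If the time
origin is placed where `k = p`, then `reparam` is the inverse of the strictly increasing `C^r`
function `k ∘ γ` and `reparamInv` is `k ∘ γ` itself (`exists_gradientCurve`).

*Energy.* At a fully mixed equilibrium of value `v` all pure strategies have payoff `v`
(`IsFullyMixedNash.exists_value`). Grouping the variables into the blocks `u = (a, μ)` and
`w = (b, λ)`, the reduced system reads `u' = -B η(w)`, `w' = Bᵀ ξ(u)`, where `B` is the payoff matrix
bordered by ones, and `ξ`, `η` act coordinatewise by strictly increasing functions with a zero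
(`reducedField_eq_conj`). The sum of the primitives of these functions is conserved, as `B` and
`-Bᵀ` form a skew-symmetric matrix, and it is coercive, each primitive being convex with a strict
minimum. Sublevel sets are thus compact and invariant. On such a set the system agrees with the one
obtained by making `ξ` and `η` constant outside a large interval, which is bounded, globally
Lipschitz and again separable; this gives the flow and its bounded orbits
(`exists_flow_hamiltonianField`).

*Recurrence.* A bounded Lipschitz separable field has a volume preserving flow
(`measurePreserving_flow_one`): the symplectic Euler scheme is a composition of shears and converges
to the flow, and the displacement of its iterates is bounded, so that integrals of compactly
supported functions pass to the limit. Hence Liouville's theorem is available without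
differentiating the flow in the initial condition, and Poincaré's recurrence theorem applies on
every energy sublevel set.

*Lifting.* If `(a, b, λ, μ)` solves the reduced system, then `θ_i(t) = γ_i(a_i(t))`,
`φ_j(t) = δ_j(b_j(t))` solve the original one (`isTrajectory_liftState`); the lift is `C^r` and a right
inverse of the reduction.
-/

namespace HiddenGame

/-! ### Trajectories of Lipschitz vector fields -/

section ODE

variable {E : Type*} [NormedAddCommGroup E] [NormedSpace ℝ E] {V : E → E}

theorem eqOn_of_hasDerivAt_of_locallyLipschitz (hV : LocallyLipschitz V) {S : Set ℝ}
    (hS : IsOpen S) (hc : IsPreconnected S) {t₀ : ℝ} (ht₀ : t₀ ∈ S) {z w : ℝ → E}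
    (hz : ∀ t ∈ S, HasDerivAt z (V (z t)) t) (hw : ∀ t ∈ S, HasDerivAt w (V (w t)) t)
    (h : z t₀ = w t₀) : EqOn z w S := by
  -- The set of agreement is open by local uniqueness and closed in `S` by continuity.
  have hsub : S ⊆ {t | z =ᶠ[𝓝 t] w} := by
    refine hc.subset_of_closure_inter_subset ?_ ⟨t₀, ht₀, ?_⟩ ?_
    · exact isOpen_iff_mem_nhds.2 fun t ht => eventually_eventuallyEq_nhds.2 ht
    · exact key ht₀ h
    · rintro t ⟨htc, htS⟩
      refine key htS ?_
      have hz' := (hz t htS).continuousAt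
      have hw' := (hw t htS).continuousAt
      rw [mem_closure_iff_frequently] at htc
      by_contra hne
      have : ∀ᶠ s in 𝓝 t, z s ≠ w s := (hz'.ne_iff_eventually_ne hw').1 hne
      obtain ⟨s, hs, hs'⟩ := (htc.and_eventually this).exists
      exact hs' hs.self_of_nhds
  exact fun t ht => (hsub ht).self_of_nhds
where
  key {t : ℝ} (ht : t ∈ S) (h : z t = w t) : z =ᶠ[𝓝 t] w := by
    obtain ⟨K, s, hs, hL⟩ := hV (z t)
    have hzt := (hz t ht).continuousAt.preimage_mem_nhds hs
    have hwt := (hw t ht).continuousAt.preimage_mem_nhds (h ▸ hs)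
    have hSt := hS.mem_nhds ht
    refine ODE_solution_unique_of_eventually (v := fun _ => V) (s := fun _ => s) (K := K)
      (.of_forall fun _ => hL) ?_ ?_ h
    · filter_upwards [hzt, hSt] with r hr hr' using ⟨hz r hr', hr⟩
    · filter_upwards [hwt, hSt] with r hr hr' using ⟨hw r hr', hr⟩

theorem IsTrajectory.eq_of_apply_eq (hV : LocallyLipschitz V) {z w : ℝ → E}
    (hz : IsTrajectory V z) (hw : IsTrajectory V w) {t₀ : ℝ} (h : z t₀ = w t₀) : z = w :=
  funext fun t => eqOn_of_hasDerivAt_of_locallyLipschitz hV isOpen_univ isPreconnected_univ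
    (mem_univ t₀) (fun t _ => hz t) (fun t _ => hw t) h (mem_univ t)

theorem IsTrajectory.comp_add {z : ℝ → E} (hz : IsTrajectory V z) (s : ℝ) :
    IsTrajectory V fun t => z (t + s) :=
  fun t => (hz (t + s)).comp_add_const t s

theorem IsTrajectory.comp_neg {z : ℝ → E} (hz : IsTrajectory V z) :
    IsTrajectory (fun x => -V x) fun t => z (-t) := by
  intro t
  simpa [Function.comp_def] using (hz (-t)).scomp t (hasDerivAt_neg t)

theorem IsTrajectory.continuous {z : ℝ → E} (hz : IsTrajectory V z) : Continuous z :=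
  continuous_iff_continuousAt.2 fun t => (hz t).continuousAt

theorem IsTrajectory.dist_le_of_nonneg {K : NNReal} (hV : LipschitzWith K V) {z w : ℝ → E}
    (hz : IsTrajectory V z) (hw : IsTrajectory V w) {t : ℝ} (ht : 0 ≤ t) :
    dist (z t) (w t) ≤ dist (z 0) (w 0) * Real.exp (K * t) := by
  simpa using dist_le_of_trajectories_ODE (v := fun _ => V) (K := K) (fun _ => hV)
    hz.continuous.continuousOn (fun s _ => (hz s).hasDerivWithinAt)
    hw.continuous.continuousOn (fun s _ => (hw s).hasDerivWithinAt) le_rfl t ⟨ht, le_rfl⟩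

theorem IsTrajectory.dist_le {K : NNReal} (hV : LipschitzWith K V) {z w : ℝ → E}
    (hz : IsTrajectory V z) (hw : IsTrajectory V w) (t : ℝ) :
    dist (z t) (w t) ≤ dist (z 0) (w 0) * Real.exp (K * |t|) := by
  rcases le_total 0 t with ht | ht
  · simpa [abs_of_nonneg ht] using hz.dist_le_of_nonneg hV hw ht
  · simpa [abs_of_nonpos ht] using
      hz.comp_neg.dist_le_of_nonneg hV.neg hw.comp_neg (neg_nonneg.2 ht)

theorem IsTrajectory.norm_sub_le {C : ℝ} (hC : ∀ x, ‖V x‖ ≤ C) {z : ℝ → E}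
    (hz : IsTrajectory V z) {t : ℝ} (ht : 0 ≤ t) : ‖z t - z 0‖ ≤ C * t := by
  simpa using norm_image_sub_le_of_norm_deriv_le_segment' (a := 0) (b := t)
    (fun s _ => (hz s).hasDerivWithinAt) (fun s _ => hC (z s)) t ⟨ht, le_rfl⟩

/-- For a bounded field, Picard–Lindelöf applies on every interval `[-T, T]`; the solutions on
these intervals are glued by uniqueness. -/
theorem exists_isTrajectory_of_lipschitz_of_bounded [CompleteSpace E] {K C : NNReal}
    (hV : LipschitzWith K V) (hC : ∀ x, ‖V x‖ ≤ C) (x : E) :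
    ∃ z, z 0 = x ∧ IsTrajectory V z := by
  have hex (T : NNReal) : ∃ α : ℝ → E, α 0 = x ∧
      ∀ t ∈ Ioo (-T : ℝ) T, HasDerivAt α (V (α t)) t := by
    have h0 : (0 : ℝ) ∈ Icc (-T : ℝ) T := by simp
    have hpl : IsPicardLindelof (fun _ => V) (⟨0, h0⟩ : Icc (-T : ℝ) T) x (C * T) 0 C K :=
      { lipschitzOnWith := fun _ _ => hV.lipschitzOnWith
        continuousOn := fun _ _ => continuousOn_const
        norm_le := fun _ _ y _ => hC y
        mul_max_le := by simp }
    obtain ⟨α, h0, hα⟩ := hpl.exists_eq_forall_mem_Icc_hasDerivWithinAt₀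
    exact ⟨α, h0, fun t ht =>
      (hα t (Ioo_subset_Icc_self ht)).hasDerivAt (Icc_mem_nhds ht.1 ht.2)⟩
  choose α hα0 hα using hex
  have heq {S T : NNReal} (hST : S ≤ T) : EqOn (α S) (α T) (Ioo (-S : ℝ) S) := by
    rcases eq_or_lt_of_le (zero_le (a := S)) with rfl | hS
    · simp
    · have hST' : (S : ℝ) ≤ T := hST
      have hS' : (0 : ℝ) < S := hS
      exact eqOn_of_hasDerivAt_of_locallyLipschitz hV.locallyLipschitz isOpen_Ioo
        isPreconnected_Ioo (t₀ := 0) (by simpa using hS) (hα S)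
        (fun t ht => hα T t ⟨by linarith [ht.1], by linarith [ht.2]⟩) (by rw [hα0, hα0])
  refine ⟨fun t => α (‖t‖₊ + 1) t, hα0 _, fun t => ?_⟩
  have hmem : t ∈ Ioo (-(‖t‖₊ + 2 : NNReal) : ℝ) (‖t‖₊ + 2 : NNReal) := by
    have := abs_lt.1 (lt_add_of_pos_right |t| (zero_lt_two' ℝ))
    simpa using this
  have hloc : (fun s => α (‖s‖₊ + 1) s) =ᶠ[𝓝 t] α (‖t‖₊ + 2) := by
    have : ∀ᶠ s in 𝓝 t, ‖s‖ < ‖t‖ + 1 :=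
      continuous_norm.continuousAt.eventually_lt continuousAt_const (lt_add_one _)
    filter_upwards [this] with s hs
    refine heq ?_ ?_
    · rw [← NNReal.coe_le_coe]; push_cast; linarith
    · have := abs_lt.1 (lt_add_one |s|)
      simpa using this
  have := (hα (‖t‖₊ + 2) t hmem).congr_of_eventuallyEq hloc
  rwa [← hloc.self_of_nhds] at this

/-- A vector field all of whose trajectories are global generates a flow, provided that near
each initial point the trajectories are those of a globally Lipschitz field `W`: the continuity of
the flow is then Grönwall's inequality for `W`. -/
theorem exists_flow_of_forall_exists_isTrajectory (hV : LocallyLipschitz V)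
    (hex : ∀ x, ∃ z, z 0 = x ∧ IsTrajectory V z)
    (hloc : ∀ x, ∃ O ∈ 𝓝 x, ∃ (K : NNReal) (W : E → E), LipschitzWith K W ∧
      ∀ z, z 0 ∈ O → IsTrajectory V z → IsTrajectory W z) :
    ∃ Φ : Flow ℝ E, ∀ x, IsTrajectory V fun t => Φ t x := by
  choose Φ hΦ0 hΦ using hex
  refine ⟨⟨fun t x => Φ x t, ?_, fun s t x => ?_, hΦ0⟩, hΦ⟩
  · rw [continuous_iff_continuousAt]
    rintro ⟨t₀, x₀⟩
    obtain ⟨O, hO, K, W, hW, hOW⟩ := hloc x₀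
    have hx₀ := hOW _ (by rw [hΦ0]; exact mem_of_mem_nhds hO) (hΦ x₀)
    have hbound : ∀ᶠ y in 𝓝 (t₀, x₀), dist (Φ y.2 y.1) (Φ x₀ t₀) ≤
        dist y.2 x₀ * Real.exp (K * |y.1|) + dist (Φ x₀ y.1) (Φ x₀ t₀) := by
      filter_upwards [continuousAt_snd.preimage_mem_nhds hO] with y hy
      refine (dist_triangle _ (Φ x₀ y.1) _).trans (add_le_add_left ?_ _)
      have := (hOW _ (by rw [hΦ0]; exact hy) (hΦ y.2)).dist_le hW hx₀ y.1
      rwa [hΦ0, hΦ0] at this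
    have hlim : Tendsto (fun y : ℝ × E => dist y.2 x₀ * Real.exp (K * |y.1|) +
        dist (Φ x₀ y.1) (Φ x₀ t₀)) (𝓝 (t₀, x₀)) (𝓝 0) := by
      have hc := (hΦ x₀).continuous
      have : Continuous fun y : ℝ × E => dist y.2 x₀ * Real.exp (K * |y.1|) +
        dist (Φ x₀ y.1) (Φ x₀ t₀) := by fun_prop
      simpa using this.tendsto (t₀, x₀)
    exact tendsto_iff_dist_tendsto_zero.2
      (squeeze_zero' (.of_forall fun _ => dist_nonneg) hbound hlim)
  · exact congrFun (IsTrajectory.eq_of_apply_eq hV ((hΦ x).comp_add t) (hΦ (Φ x t)) (t₀ := 0)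
      (by simp [hΦ0])) s

theorem exists_flow_of_lipschitz_of_bounded [CompleteSpace E] {K C : NNReal}
    (hV : LipschitzWith K V) (hC : ∀ x, ‖V x‖ ≤ C) :
    ∃ Φ : Flow ℝ E, ∀ x, IsTrajectory V fun t => Φ t x :=
  exists_flow_of_forall_exists_isTrajectory hV.locallyLipschitz
    (exists_isTrajectory_of_lipschitz_of_bounded hV hC)
    fun _ => ⟨univ, univ_mem, K, V, hV, fun _ _ h => h⟩

end ODE

/-! ### Flows of separable fields preserve volume -/

section Liouville

variable {E F : Type*} [NormedAddCommGroup E] [NormedAddCommGroup F]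

/-- The separable vector field `u' = P(w)`, `w' = Q(u)`. -/
def separableField (P : F → E) (Q : E → F) (x : E × F) : E × F := (P x.2, Q x.1)

variable {P : F → E} {Q : E → F} {K C : NNReal}

theorem lipschitzWith_separableField (hP : LipschitzWith K P) (hQ : LipschitzWith K Q) :
    LipschitzWith K (separableField P Q) := by
  refine LipschitzWith.of_dist_le_mul fun x y => max_le ?_ ?_
  · refine (hP.dist_le_mul _ _).trans ?_
    gcongr
    exact le_max_right _ _
  · refine (hQ.dist_le_mul _ _).trans ?_
    gcongr
    exact le_max_left _ _

theorem norm_separableField_le (hPC : ∀ w, ‖P w‖ ≤ C) (hQC : ∀ u, ‖Q u‖ ≤ C) (x : E × F) :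
    ‖separableField P Q x‖ ≤ C :=
  max_le (hPC _) (hQC _)

variable [NormedSpace ℝ E] [NormedSpace ℝ F]

/-- One step of size `h` of the symplectic Euler scheme for `u' = P(w)`, `w' = Q(u)`: the new
value of `u` is already used to update `w`, which makes the step a composition of two shears. -/
def symplecticEuler (P : F → E) (Q : E → F) (h : ℝ) (x : E × F) : E × F :=
  (x.1 + h • P x.2, x.2 + h • Q (x.1 + h • P x.2))

theorem norm_symplecticEuler_sub_le (hPC : ∀ w, ‖P w‖ ≤ C) (hQC : ∀ u, ‖Q u‖ ≤ C) {h : ℝ}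
    (hh : 0 ≤ h) (x : E × F) : ‖symplecticEuler P Q h x - x‖ ≤ C * h := by
  have h1 : ‖h • P x.2‖ ≤ C * h := by
    rw [norm_smul, Real.norm_of_nonneg hh, mul_comm]
    gcongr
    exact hPC _
  have h2 : ‖h • Q (x.1 + h • P x.2)‖ ≤ C * h := by
    rw [norm_smul, Real.norm_of_nonneg hh, mul_comm]
    gcongr
    exact hQC _
  refine max_le ?_ ?_
  · simpa [symplecticEuler] using h1
  · simpa [symplecticEuler] using h2

theorem norm_symplecticEuler_iterate_sub_le (hPC : ∀ w, ‖P w‖ ≤ C) (hQC : ∀ u, ‖Q u‖ ≤ C)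
    {h : ℝ} (hh : 0 ≤ h) (x : E × F) (k : ℕ) :
    ‖(symplecticEuler P Q h)^[k] x - x‖ ≤ k * (C * h) := by
  induction k with
  | zero => simp
  | succ k ih =>
    rw [Function.iterate_succ_apply']
    have := norm_symplecticEuler_sub_le hPC hQC hh ((symplecticEuler P Q h)^[k] x)
    have := norm_sub_le_norm_sub_add_norm_sub
      (symplecticEuler P Q h ((symplecticEuler P Q h)^[k] x)) ((symplecticEuler P Q h)^[k] x) x
    push_cast
    linarith

/-- The local error of the symplectic Euler scheme is of second order. -/
theorem norm_trajectory_sub_symplecticEuler_le (hP : LipschitzWith K P) (hQ : LipschitzWith K Q)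
    (hPC : ∀ w, ‖P w‖ ≤ C) (hQC : ∀ u, ‖Q u‖ ≤ C) {z : ℝ → E × F}
    (hz : IsTrajectory (separableField P Q) z) {h : ℝ} (hh : 0 ≤ h) :
    ‖z h - symplecticEuler P Q h (z 0)‖ ≤ 2 * K * C * h ^ 2 := by
  -- The velocity of the Euler step is a constant `c`; compare `V(z(s))` with it.
  set c : E × F := (P (z 0).2, Q ((z 0).1 + h • P (z 0).2)) with hc
  have hder (s : ℝ) : HasDerivAt (fun s => z s - s • c) (separableField P Q (z s) - c) s := by
    have := (hz s).sub ((hasDerivAt_id s).smul_const c)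
    rwa [one_smul] at this
  have hbound (s : ℝ) (hs : s ∈ Ico 0 h) :
      ‖separableField P Q (z s) - c‖ ≤ 2 * K * C * h := by
    have hzs := hz.norm_sub_le (norm_separableField_le hPC hQC) hs.1
    have hCs : C * s ≤ C * h := by have := hs.2.le; gcongr
    have h1 : ‖(z s).1 - (z 0).1‖ ≤ C * h := (norm_fst_le (z s - z 0)).trans (hzs.trans hCs)
    have h2 : ‖(z s).2 - (z 0).2‖ ≤ C * h := (norm_snd_le (z s - z 0)).trans (hzs.trans hCs)
    have hKC : 0 ≤ K * C * h := by positivity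
    refine max_le ?_ ?_
    · have := hP.norm_sub_le (z s).2 (z 0).2
      have : K * ‖(z s).2 - (z 0).2‖ ≤ K * (C * h) := by gcongr
      simp only [separableField, hc, Prod.fst_sub]
      linarith
    · have h3 : ‖(z s).1 - ((z 0).1 + h • P (z 0).2)‖ ≤ C * h + C * h := by
        rw [← sub_sub]
        refine (norm_sub_le _ _).trans (add_le_add h1 ?_)
        rw [norm_smul, Real.norm_of_nonneg hh, mul_comm]
        gcongr
        exact hPC _
      have := hQ.norm_sub_le (z s).1 ((z 0).1 + h • P (z 0).2)
      have : K * ‖(z s).1 - ((z 0).1 + h • P (z 0).2)‖ ≤ K * (C * h + C * h) := by gcongr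
      simp only [separableField, hc, Prod.snd_sub]
      linarith
  have := norm_image_sub_le_of_norm_deriv_le_segment' (a := 0) (b := h)
    (fun s _ => (hder s).hasDerivWithinAt) hbound h ⟨hh, le_rfl⟩
  have heq : z h - symplecticEuler P Q h (z 0) = z h - h • c - (z 0 - (0 : ℝ) • c) := by
    ext <;> simp [symplecticEuler, hc, sub_sub, add_comm]
  rw [heq]
  refine this.trans_eq ?_
  ring

/-- The global error of the symplectic Euler scheme. -/
theorem norm_flow_sub_symplecticEuler_iterate_le (hP : LipschitzWith K P)
    (hQ : LipschitzWith K Q) (hPC : ∀ w, ‖P w‖ ≤ C) (hQC : ∀ u, ‖Q u‖ ≤ C)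
    {Φ : Flow ℝ (E × F)} (hΦ : ∀ x, IsTrajectory (separableField P Q) fun t => Φ t x)
    {h : ℝ} (hh : 0 ≤ h) (x : E × F) (k : ℕ) :
    ‖Φ (k * h) x - (symplecticEuler P Q h)^[k] x‖ ≤
      k * (2 * K * C * h ^ 2) * Real.exp (K * (k * h)) := by
  induction k with
  | zero => simp
  | succ k ih =>
    set S := symplecticEuler P Q h
    rw [Function.iterate_succ_apply']
    have h1 : Φ ((k + 1 : ℕ) * h) x = Φ h (Φ (k * h) x) := by
      rw [← Φ.map_add]; congr 1; push_cast; ring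
    have h2 : ‖Φ h (Φ (k * h) x) - Φ h (S^[k] x)‖ ≤
        ‖Φ (k * h) x - S^[k] x‖ * Real.exp (K * h) := by
      simpa [dist_eq_norm] using (hΦ (Φ (k * h) x)).dist_le_of_nonneg
        (lipschitzWith_separableField hP hQ) (hΦ (S^[k] x)) hh
    have h3 : ‖Φ h (S^[k] x) - S (S^[k] x)‖ ≤ 2 * K * C * h ^ 2 := by
      simpa using norm_trajectory_sub_symplecticEuler_le hP hQ hPC hQC (hΦ (S^[k] x)) hh
    have h4 : ‖Φ (k * h) x - S^[k] x‖ * Real.exp (K * h) ≤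
        k * (2 * K * C * h ^ 2) * Real.exp (K * (k * h)) * Real.exp (K * h) := by gcongr
    have h5 : Real.exp (K * (k * h)) * Real.exp (K * h) = Real.exp (K * ((k + 1 : ℕ) * h)) := by
      rw [← Real.exp_add]; congr 1; push_cast; ring
    have h6 : 1 ≤ Real.exp (K * ((k + 1 : ℕ) * h)) := Real.one_le_exp (by positivity)
    have h7 : 2 * K * C * h ^ 2 ≤ 2 * K * C * h ^ 2 * Real.exp (K * ((k + 1 : ℕ) * h)) :=
      le_mul_of_one_le_right (by positivity) h6
    rw [mul_assoc, h5] at h4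
    have := norm_sub_le_norm_sub_add_norm_sub (Φ h (Φ (k * h) x)) (Φ h (S^[k] x)) (S (S^[k] x))
    rw [h1]
    calc _ ≤ k * (2 * K * C * h ^ 2) * Real.exp (K * ((k + 1 : ℕ) * h)) +
          2 * K * C * h ^ 2 * Real.exp (K * ((k + 1 : ℕ) * h)) := by linarith
      _ = _ := by push_cast; ring

theorem tendsto_symplecticEuler_iterate (hP : LipschitzWith K P)
    (hQ : LipschitzWith K Q) (hPC : ∀ w, ‖P w‖ ≤ C) (hQC : ∀ u, ‖Q u‖ ≤ C)
    {Φ : Flow ℝ (E × F)} (hΦ : ∀ x, IsTrajectory (separableField P Q) fun t => Φ t x)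
    (x : E × F) :
    Tendsto (fun k : ℕ => (symplecticEuler P Q (1 / (k + 1 : ℝ)))^[k + 1] x) atTop
      (𝓝 (Φ 1 x)) := by
  rw [tendsto_iff_norm_sub_tendsto_zero]
  have hlim : Tendsto (fun k : ℕ => 2 * K * C * Real.exp K * (1 / ((k : ℝ) + 1))) atTop (𝓝 0) := by
    simpa using tendsto_one_div_add_atTop_nhds_zero_nat.const_mul (2 * K * C * Real.exp K)
  refine squeeze_zero (fun _ => norm_nonneg _) (fun k => ?_) hlim
  have hk : (0 : ℝ) < k + 1 := by positivity
  have := norm_flow_sub_symplecticEuler_iterate_le hP hQ hPC hQC hΦ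
    (h := 1 / (k + 1 : ℝ)) (by positivity) x (k + 1)
  push_cast at this
  rw [mul_one_div_cancel hk.ne', mul_one] at this
  rw [norm_sub_rev]
  refine this.trans_eq ?_
  field_simp

variable [FiniteDimensional ℝ E] [FiniteDimensional ℝ F]
  [MeasureSpace E] [BorelSpace E] [MeasureSpace F] [BorelSpace F]
  [(volume : Measure E).IsAddHaarMeasure] [(volume : Measure F).IsAddHaarMeasure]

theorem measurePreserving_symplecticEuler (hP : Continuous P) (hQ : Continuous Q) (h : ℝ) :
    MeasurePreserving (symplecticEuler P Q h) volume volume := by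
  have h1 : MeasurePreserving (fun x : F × E => (x.1, x.2 + h • P x.1)) volume volume :=
    (MeasurePreserving.id volume).skew_product (g := fun w u => u + h • P w)
      (by unfold Function.uncurry; fun_prop) (.of_forall fun _ =>
        (measurePreserving_add_right volume _).map_eq)
  have h2 : MeasurePreserving (fun x : E × F => (x.1, x.2 + h • Q x.1)) volume volume :=
    (MeasurePreserving.id volume).skew_product (g := fun u w => w + h • Q u)
      (by unfold Function.uncurry; fun_prop) (.of_forall fun _ =>
        (measurePreserving_add_right volume _).map_eq)
  exact h2.comp ((Measure.measurePreserving_swap.comp h1).comp Measure.measurePreserving_swap)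

/-- Liouville's theorem for separable fields: the time-one map is a limit of compositions of
shears, and a pointwise limit of volume preserving maps of bounded displacement preserves the
integrals of compactly supported functions. -/
theorem measurePreserving_flow_one (hP : LipschitzWith K P)
    (hQ : LipschitzWith K Q) (hPC : ∀ w, ‖P w‖ ≤ C) (hQC : ∀ u, ‖Q u‖ ≤ C)
    {Φ : Flow ℝ (E × F)} (hΦ : ∀ x, IsTrajectory (separableField P Q) fun t => Φ t x) :
    MeasurePreserving (Φ 1) volume volume := by
  have hcont : Continuous (Φ 1) := Φ.continuous_toFun 1
  refine ⟨hcont.measurable, ?_⟩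
  -- Regularity of the image measure, needed to test it on compactly supported functions.
  have hlf : IsFiniteMeasureOnCompacts (Measure.map (Φ 1) volume) := by
    refine ⟨fun A hA => ?_⟩
    rw [Measure.map_apply hcont.measurable hA.measurableSet]
    exact ((Φ.toHomeomorph 1).isCompact_preimage.2 hA).measure_lt_top
  refine Measure.ext_of_integral_eq_on_compactlySupported fun f => ?_
  have hf : Continuous f := map_continuous f
  rw [integral_map hcont.aemeasurable hf.aestronglyMeasurable]
  obtain ⟨ρ, hρ⟩ := f.hasCompactSupport.isBounded.subset_closedBall 0
  obtain ⟨A, hA⟩ := hf.bounded_above_of_compact_support f.hasCompactSupport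
  set S := fun k : ℕ => (symplecticEuler P Q (1 / (k + 1 : ℝ)))^[k + 1]
  have hS (k : ℕ) : MeasurePreserving (S k) volume volume :=
    (measurePreserving_symplecticEuler hP.continuous hQ.continuous _).iterate _
  have hdispl (k : ℕ) (x : E × F) : ‖S k x - x‖ ≤ C := by
    have hk : (0 : ℝ) < k + 1 := by positivity
    have := norm_symplecticEuler_iterate_sub_le hPC hQC
      (h := 1 / (k + 1 : ℝ)) (by positivity) x (k + 1)
    push_cast at this
    rwa [mul_left_comm, mul_one_div_cancel hk.ne', mul_one] at this
  have hint (k : ℕ) : ∫ x, f (S k x) = ∫ x, f x := by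
    conv_rhs => rw [← (hS k).map_eq]
    exact (integral_map (hS k).measurable.aemeasurable
      hf.aestronglyMeasurable).symm
  -- All `f ∘ S k` are supported in one ball, as the maps `S k` move points by at most `C`.
  have hlim : Tendsto (fun k => ∫ x, f (S k x)) atTop (𝓝 (∫ x, f (Φ 1 x))) := by
    refine tendsto_integral_of_dominated_convergence
      ((Metric.closedBall 0 (ρ + C)).indicator fun _ => A) (fun k => ?_) ?_ (fun k => ?_) ?_
    · exact (hf.measurable.comp (hS k).measurable).aestronglyMeasurable
    · exact (integrableOn_const
        (isCompact_closedBall (0 : E × F) (ρ + C)).measure_lt_top.ne).integrable_indicator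
        Metric.isClosed_closedBall.measurableSet
    · refine .of_forall fun x => ?_
      by_cases hx : x ∈ Metric.closedBall 0 (ρ + C)
      · simpa [hx] using hA (S k x)
      · have : f (S k x) = 0 := by
          by_contra hne
          have h1 := hρ (subset_tsupport _ hne)
          rw [mem_closedBall_zero_iff] at h1 hx
          have := norm_sub_norm_le x (S k x)
          rw [norm_sub_rev] at this
          linarith [hdispl k x]
        simp [this, hx]
    · exact .of_forall fun x => (hf.tendsto _).comp
        (tendsto_symplecticEuler_iterate hP hQ hPC hQC hΦ x)
  exact tendsto_nhds_unique hlim (by simp [hint])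

end Liouville

/-! ### Potentials of monotone functions -/

section Potential

/-- The primitive of `ξ` that vanishes at `c`. -/
noncomputable def potential (ξ : ℝ → ℝ) (c s : ℝ) : ℝ := ∫ x in c..s, ξ x

/-- The function that agrees with `ξ` on `[-R, R]` and is constant on each side of this interval
(for `R ≥ 0`). -/
def clampComp (R : ℝ) (ξ : ℝ → ℝ) (s : ℝ) : ℝ := ξ (max (-R) (min R s))

variable {ξ : ℝ → ℝ} {c R : ℝ}

theorem hasDerivAt_potential (hξ : Continuous ξ) (s : ℝ) :
    HasDerivAt (potential ξ c) (ξ s) s :=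
  intervalIntegral.integral_hasDerivAt_right (hξ.intervalIntegrable _ _)
    (hξ.stronglyMeasurableAtFilter _ _) hξ.continuousAt

/-- The gradient inequality for the convex function `potential ξ c`. -/
theorem potential_add_mul_sub_le (hξ : Continuous ξ) (hm : Monotone ξ) (b s : ℝ) :
    potential ξ c b + ξ b * (s - b) ≤ potential ξ c s := by
  have h1 : potential ξ c s - potential ξ c b = ∫ x in b..s, ξ x :=
    intervalIntegral.integral_interval_sub_left (hξ.intervalIntegrable _ _)
      (hξ.intervalIntegrable _ _)
  have h2 : ξ b * (s - b) = ∫ _ in b..s, ξ b := by simp [mul_comm]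
  suffices ∫ _ in b..s, ξ b ≤ ∫ x in b..s, ξ x by linarith
  rcases le_total b s with h | h
  · exact intervalIntegral.integral_mono_on h (by simp) (hξ.intervalIntegrable _ _)
      fun x hx => hm hx.1
  · rw [intervalIntegral.integral_symm s b, intervalIntegral.integral_symm s b, neg_le_neg_iff]
    exact intervalIntegral.integral_mono_on h (hξ.intervalIntegrable _ _) (by simp)
      fun x hx => hm hx.2

theorem potential_self : potential ξ c c = 0 := intervalIntegral.integral_same

theorem potential_nonneg (hξ : Continuous ξ) (hm : Monotone ξ) (hc : ξ c = 0) (s : ℝ) :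
    0 ≤ potential ξ c s := by
  simpa [potential_self, hc] using potential_add_mul_sub_le (c := c) hξ hm c s

theorem potential_le_potential_of_le (hξ : Continuous ξ) (hm : Monotone ξ) (hc : ξ c = 0)
    {s t : ℝ} (hs : c ≤ s) (hst : s ≤ t) : potential ξ c s ≤ potential ξ c t := by
  have := potential_add_mul_sub_le (c := c) hξ hm s t
  have := mul_nonneg (hc.symm.trans_le (hm hs)) (sub_nonneg.2 hst)
  linarith

theorem potential_le_potential_of_ge (hξ : Continuous ξ) (hm : Monotone ξ) (hc : ξ c = 0)
    {s t : ℝ} (hs : s ≤ c) (hst : t ≤ s) : potential ξ c s ≤ potential ξ c t := by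
  have := potential_add_mul_sub_le (c := c) hξ hm s t
  have := mul_nonneg_of_nonpos_of_nonpos ((hm hs).trans_eq hc) (sub_nonpos.2 hst)
  linarith

theorem eventually_lt_potential (hξ : Continuous ξ) (hm : StrictMono ξ) (hc : ξ c = 0) (h : ℝ) :
    ∀ᶠ R in atTop, h < potential ξ c R ∧ h < potential ξ c (-R) := by
  have h1 : 0 < ξ (c + 1) := hc.symm.trans_lt (hm (lt_add_one c))
  have h2 : ξ (c - 1) < 0 := (hm (sub_one_lt c)).trans_eq hc
  have hp1 := potential_nonneg hξ hm.monotone hc (c + 1)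
  have hp2 := potential_nonneg hξ hm.monotone hc (c - 1)
  have hl1 : Tendsto (fun R => ξ (c + 1) * (R - (c + 1))) atTop atTop :=
    (tendsto_atTop_add_const_right _ _ tendsto_id).const_mul_atTop h1
  have hl2 : Tendsto (fun R => -ξ (c - 1) * (R + (c - 1))) atTop atTop :=
    (tendsto_atTop_add_const_right _ _ tendsto_id).const_mul_atTop (neg_pos.2 h2)
  filter_upwards [hl1.eventually_gt_atTop h, hl2.eventually_gt_atTop h] with R hR1 hR2
  have h3 := potential_add_mul_sub_le (c := c) hξ hm.monotone (c + 1) R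
  have h4 := potential_add_mul_sub_le (c := c) hξ hm.monotone (c - 1) (-R)
  constructor
  · linarith
  · linarith

theorem clampComp_of_abs_le {s : ℝ} (hs : |s| ≤ R) : clampComp R ξ s = ξ s := by
  rw [abs_le] at hs
  simp [clampComp, hs.1, hs.2]

theorem continuous_clampComp (hξ : Continuous ξ) : Continuous (clampComp R ξ) := by
  unfold HiddenGame.clampComp
  fun_prop

theorem monotone_clampComp (hξ : Monotone ξ) : Monotone (clampComp R ξ) :=
  fun _ _ h => hξ (max_le_max le_rfl (min_le_min le_rfl h))

theorem potential_clampComp {s : ℝ} (hc : |c| ≤ R) (hs : |s| ≤ R) :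
    potential (clampComp R ξ) c s = potential ξ c s :=
  intervalIntegral.integral_congr fun _ hx =>
    clampComp_of_abs_le (abs_le.2 (uIcc_subset_Icc (abs_le.1 hc) (abs_le.1 hs) hx))

/-- For large `R`, replacing `ξ` by `clampComp R ξ` changes neither a given sublevel set of its
potential nor the values there. -/
theorem eventually_potential_clampComp (hξ : Continuous ξ) (hm : StrictMono ξ) (hc : ξ c = 0)
    (h : ℝ) : ∀ᶠ R in atTop, ∀ s, potential (clampComp R ξ) c s ≤ h ∨ potential ξ c s ≤ h →
      |s| ≤ R ∧ potential (clampComp R ξ) c s = potential ξ c s := by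
  filter_upwards [eventually_ge_atTop |c|, eventually_lt_potential hξ hm hc h] with R hR hh s hs
  have hcR := abs_le.1 hR
  have hR0 : |R| ≤ R := (abs_of_nonneg ((abs_nonneg c).trans hR)).le
  have hR0' : |-R| ≤ R := by rwa [abs_neg]
  have hcl : clampComp R ξ c = 0 := by rw [clampComp_of_abs_le hR, hc]
  have hp := potential_clampComp (ξ := ξ) hR hR0
  have hp' := potential_clampComp (ξ := ξ) hR hR0'
  have hsR : |s| ≤ R := by
    by_contra hlt
    rcases lt_abs.1 (not_le.1 hlt) with h1 | h1
    · have h2 := potential_le_potential_of_le hξ hm.monotone hc hcR.2 h1.le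
      have h3 := potential_le_potential_of_le (continuous_clampComp hξ)
        (monotone_clampComp hm.monotone) hcl hcR.2 h1.le
      rcases hs with hs | hs <;> linarith [hh.1]
    · have h1 : s ≤ -R := by linarith
      have h2 := potential_le_potential_of_ge hξ hm.monotone hc hcR.1 h1
      have h3 := potential_le_potential_of_ge (continuous_clampComp hξ)
        (monotone_clampComp hm.monotone) hcl hcR.1 h1
      rcases hs with hs | hs <;> linarith [hh.2]
  exact ⟨hsR, potential_clampComp hR hsR⟩

theorem exists_lipschitzWith_clampComp (hξ : ContDiff ℝ 1 ξ) (hR : 0 ≤ R) :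
    ∃ K C : NNReal, LipschitzWith K (clampComp R ξ) ∧ ∀ s, ‖clampComp R ξ s‖ ≤ C := by
  obtain ⟨K, hK⟩ := hξ.contDiffOn.exists_lipschitzOnWith one_ne_zero (convex_Icc (-R) R)
    isCompact_Icc
  obtain ⟨C, hC⟩ := isCompact_Icc.exists_bound_of_continuousOn
    (hξ.continuous.continuousOn (s := Icc (-R) R))
  have hmem (s : ℝ) : max (-R) (min R s) ∈ Icc (-R) R :=
    ⟨le_max_left _ _, max_le (by linarith) (min_le_left _ _)⟩
  have hcl : LipschitzWith 1 fun s : ℝ => max (-R) (min R s) :=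
    (LipschitzWith.id.const_min R).const_max (-R)
  refine ⟨K * 1, C.toNNReal, ?_, fun s => (hC _ (hmem s)).trans (Real.le_coe_toNNReal C)⟩
  exact lipschitzOnWith_univ.1 <| hK.comp (hcl.lipschitzOnWith (s := univ)) (fun s _ => hmem s)

end Potential

/-! ### Separable Hamiltonian systems with coercive energy -/

section Hamiltonian

variable {I J : Type*} [Fintype I] [Fintype J]

/-- The vector field `u' = -B η(w)`, `w' = Bᵀ ξ(u)`, where `ξ` and `η` act coordinatewise. -/
def hamiltonianField (B : Matrix I J ℝ) (ξ : I → ℝ → ℝ) (η : J → ℝ → ℝ) :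
    (I → ℝ) × (J → ℝ) → (I → ℝ) × (J → ℝ) :=
  separableField (fun w => (-B).mulVec fun j => η j (w j))
    (fun u => B.transpose.mulVec fun i => ξ i (u i))

/-- The energy `∑ Ξ_i(u_i) + ∑ H_j(w_j)`, where `Ξ_i` and `H_j` are primitives of `ξ_i`
and `η_j`. -/
noncomputable def energy (ξ : I → ℝ → ℝ) (η : J → ℝ → ℝ) (c : I → ℝ) (d : J → ℝ)
    (x : (I → ℝ) × (J → ℝ)) : ℝ :=
  ∑ i, potential (ξ i) (c i) (x.1 i) + ∑ j, potential (η j) (d j) (x.2 j)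

variable {B : Matrix I J ℝ} {ξ : I → ℝ → ℝ} {η : J → ℝ → ℝ} {c : I → ℝ} {d : J → ℝ}

theorem continuous_energy (hξ : ∀ i, Continuous (ξ i)) (hη : ∀ j, Continuous (η j)) :
    Continuous (energy ξ η c d) := by
  have h1 (i) : Continuous (potential (ξ i) (c i)) :=
    continuous_iff_continuousAt.2 fun s => (hasDerivAt_potential (hξ i) s).continuousAt
  have h2 (j) : Continuous (potential (η j) (d j)) :=
    continuous_iff_continuousAt.2 fun s => (hasDerivAt_potential (hη j) s).continuousAt
  unfold energy
  fun_prop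

/-- The energy is conserved because `B` and `-Bᵀ` are the two blocks of a skew-symmetric
matrix. -/
theorem energy_eq_of_isTrajectory (hξ : ∀ i, Continuous (ξ i)) (hη : ∀ j, Continuous (η j))
    {z : ℝ → (I → ℝ) × (J → ℝ)} (hz : IsTrajectory (hamiltonianField B ξ η) z) (t : ℝ) :
    energy ξ η c d (z t) = energy ξ η c d (z 0) := by
  have hder (t : ℝ) : HasDerivAt (fun t => energy ξ η c d (z t)) 0 t := by
    have h1 (i) : HasDerivAt (fun t => (z t).1 i) ((hamiltonianField B ξ η (z t)).1 i) t :=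
      hasDerivAt_pi.1 ((ContinuousLinearMap.fst ℝ _ _).hasFDerivAt.comp_hasDerivAt t (hz t)) i
    have h2 (j) : HasDerivAt (fun t => (z t).2 j) ((hamiltonianField B ξ η (z t)).2 j) t :=
      hasDerivAt_pi.1 ((ContinuousLinearMap.snd ℝ _ _).hasFDerivAt.comp_hasDerivAt t (hz t)) j
    have h3 := (HasDerivAt.fun_sum (u := Finset.univ)
      fun i _ => (hasDerivAt_potential (c := c i) (hξ i) ((z t).1 i)).comp t (h1 i)).add
      (HasDerivAt.fun_sum (u := Finset.univ)
      fun j _ => (hasDerivAt_potential (c := d j) (hη j) ((z t).2 j)).comp t (h2 j))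
    refine h3.congr_deriv ?_
    set a : I → ℝ := fun i => ξ i ((z t).1 i)
    set b : J → ℝ := fun j => η j ((z t).2 j)
    change a ⬝ᵥ (-B).mulVec b + b ⬝ᵥ B.transpose.mulVec a = 0
    rw [Matrix.neg_mulVec, dotProduct_neg, Matrix.mulVec_transpose, Matrix.dotProduct_mulVec,
      dotProduct_comm b]
    ring
  exact is_const_of_deriv_eq_zero (fun t => (hder t).differentiableAt)
    (fun t => (hder t).deriv) t 0

theorem locallyLipschitz_hamiltonianField (hξ : ∀ i, ContDiff ℝ 1 (ξ i))
    (hη : ∀ j, ContDiff ℝ 1 (η j)) : LocallyLipschitz (hamiltonianField B ξ η) := by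
  refine ContDiff.locallyLipschitz (𝕂 := ℝ) (ContDiff.prodMk ?_ ?_)
  · refine contDiff_pi.2 fun i => ?_
    simp only [Matrix.mulVec, dotProduct]
    fun_prop
  · refine contDiff_pi.2 fun i => ?_
    simp only [Matrix.mulVec, dotProduct]
    fun_prop

theorem exists_lipschitzWith_mulVec_clampComp {R : ℝ} (hR : 0 ≤ R) (A : Matrix J I ℝ)
    (hξ : ∀ i, ContDiff ℝ 1 (ξ i)) :
    ∃ K C : NNReal, LipschitzWith K (fun u : I → ℝ => A.mulVec fun i => clampComp R (ξ i) (u i)) ∧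
      ∀ u : I → ℝ, ‖A.mulVec fun i => clampComp R (ξ i) (u i)‖ ≤ C := by
  choose K C hK hC using fun i => exists_lipschitzWith_clampComp (hξ i) hR
  have hf : LipschitzWith (∑ i, K i) fun (u : I → ℝ) i => clampComp R (ξ i) (u i) := by
    refine LipschitzWith.of_dist_le_mul fun u v => ?_
    refine (dist_pi_le_iff (by positivity)).2 fun i => ((hK i).dist_le_mul _ _).trans ?_
    gcongr
    · exact Finset.single_le_sum (f := K) (fun _ _ => zero_le) (Finset.mem_univ i)
    · exact dist_le_pi_dist u v i
  have hb (u : I → ℝ) : ‖fun i => clampComp R (ξ i) (u i)‖ ≤ (∑ i, C i : NNReal) := by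
    refine (pi_norm_le_iff_of_nonneg (by positivity)).2 fun i => (hC i _).trans ?_
    exact_mod_cast Finset.single_le_sum (f := C) (fun _ _ => zero_le) (Finset.mem_univ i)
  set T : (I → ℝ) →L[ℝ] (J → ℝ) := A.mulVecLin.toContinuousLinearMap
  refine ⟨‖T‖₊ * ∑ i, K i, ‖T‖₊ * ∑ i, C i, T.lipschitz.comp hf, fun u => ?_⟩
  refine (T.le_opNorm fun i => clampComp R (ξ i) (u i)).trans ?_
  push_cast
  gcongr
  exact_mod_cast hb u

/-- For large `R`, clamping `ξ` and `η` changes neither a given sublevel set of the energy nor the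
values there, and this sublevel set lies in the box where the clamped and the original functions
agree. -/
theorem exists_energy_clampComp (hξ : ∀ i, Continuous (ξ i)) (hη : ∀ j, Continuous (η j))
    (hξm : ∀ i, StrictMono (ξ i)) (hηm : ∀ j, StrictMono (η j))
    (hc : ∀ i, ξ i (c i) = 0) (hd : ∀ j, η j (d j) = 0) (h : ℝ) :
    ∃ R, 0 ≤ R ∧ ∀ x,
      energy (fun i => clampComp R (ξ i)) (fun j => clampComp R (η j)) c d x ≤ h ∨
        energy ξ η c d x ≤ h →
      ‖x‖ ≤ R ∧ energy (fun i => clampComp R (ξ i)) (fun j => clampComp R (η j)) c d x =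
        energy ξ η c d x := by
  have h1 := eventually_all.2 fun i =>
    eventually_potential_clampComp (hξ i) (hξm i) (hc i) h
  have h2 := eventually_all.2 fun j =>
    eventually_potential_clampComp (hη j) (hηm j) (hd j) h
  have h3 : ∀ᶠ R in atTop, ∀ i, |c i| ≤ R := eventually_all.2 fun i => eventually_ge_atTop _
  have h4 : ∀ᶠ R in atTop, ∀ j, |d j| ≤ R := eventually_all.2 fun j => eventually_ge_atTop _
  obtain ⟨R, ⟨⟨⟨hR0, hRξ⟩, hRη⟩, hRc⟩, hRd⟩ :=
    (((((eventually_ge_atTop (0 : ℝ)).and h1).and h2).and h3).and h4).exists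
  have hterm {f : I → ℝ} {g : J → ℝ} (hf : ∀ i, 0 ≤ f i) (hg : ∀ j, 0 ≤ g j)
      (hfg : ∑ i, f i + ∑ j, g j ≤ h) : (∀ i, f i ≤ h) ∧ ∀ j, g j ≤ h := by
    have hf' := Finset.sum_nonneg fun i (_ : i ∈ Finset.univ) => hf i
    have hg' := Finset.sum_nonneg fun j (_ : j ∈ Finset.univ) => hg j
    refine ⟨fun i => ?_, fun j => ?_⟩
    · linarith [Finset.single_le_sum (fun i _ => hf i) (Finset.mem_univ i)]
    · linarith [Finset.single_le_sum (fun j _ => hg j) (Finset.mem_univ j)]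
  refine ⟨R, hR0, fun x hx => ?_⟩
  have hx' : (∀ i, potential (clampComp R (ξ i)) (c i) (x.1 i) ≤ h ∨
      potential (ξ i) (c i) (x.1 i) ≤ h) ∧ ∀ j, potential (clampComp R (η j)) (d j) (x.2 j) ≤ h ∨
      potential (η j) (d j) (x.2 j) ≤ h := by
    rcases hx with hx | hx
    · have := hterm (fun i => potential_nonneg (continuous_clampComp (hξ i))
        (monotone_clampComp (hξm i).monotone) (by rw [clampComp_of_abs_le (hRc i), hc]) _)
        (fun j => potential_nonneg (continuous_clampComp (hη j))
        (monotone_clampComp (hηm j).monotone) (by rw [clampComp_of_abs_le (hRd j), hd]) _) hx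
      exact ⟨fun i => .inl (this.1 i), fun j => .inl (this.2 j)⟩
    · have := hterm (fun i => potential_nonneg (hξ i) (hξm i).monotone (hc i) _)
        (fun j => potential_nonneg (hη j) (hηm j).monotone (hd j) _) hx
      exact ⟨fun i => .inr (this.1 i), fun j => .inr (this.2 j)⟩
  refine ⟨max_le ?_ ?_, ?_⟩
  · exact (pi_norm_le_iff_of_nonneg hR0).2 fun i => (hRξ i _ (hx'.1 i)).1
  · exact (pi_norm_le_iff_of_nonneg hR0).2 fun j => (hRη j _ (hx'.2 j)).1
  · exact congrArg₂ (· + ·) (Finset.sum_congr rfl fun i _ => (hRξ i _ (hx'.1 i)).2)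
      (Finset.sum_congr rfl fun j _ => (hRη j _ (hx'.2 j)).2)

theorem hamiltonianField_clampComp {R : ℝ} {x : (I → ℝ) × (J → ℝ)} (hx : ‖x‖ ≤ R) :
    hamiltonianField B (fun i => clampComp R (ξ i)) (fun j => clampComp R (η j)) x =
      hamiltonianField B ξ η x := by
  have h1 (i) : |x.1 i| ≤ R := (norm_le_pi_norm x.1 i).trans ((norm_fst_le x).trans hx)
  have h2 (j) : |x.2 j| ≤ R := (norm_le_pi_norm x.2 j).trans ((norm_snd_le x).trans hx)
  simp only [hamiltonianField, separableField, clampComp_of_abs_le (h1 _),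
    clampComp_of_abs_le (h2 _)]

/-- On an energy sublevel set the system coincides with a bounded globally Lipschitz one, whose
flow exists, conserves the energy and preserves volume; Poincaré's recurrence theorem applies on
each sublevel set, which has finite volume. -/
theorem exists_flow_hamiltonianField (B : Matrix I J ℝ) (hξ : ∀ i, ContDiff ℝ 1 (ξ i))
    (hη : ∀ j, ContDiff ℝ 1 (η j)) (hξm : ∀ i, StrictMono (ξ i)) (hηm : ∀ j, StrictMono (η j))
    (hc : ∀ i, ξ i (c i) = 0) (hd : ∀ j, η j (d j) = 0) :
    ∃ Φ : Flow ℝ ((I → ℝ) × (J → ℝ)),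
      (∀ x, IsTrajectory (hamiltonianField B ξ η) fun t => Φ t x) ∧
      (∀ x, Bornology.IsBounded (range fun t => Φ t x)) ∧
      ∀ᵐ x, ∀ O ∈ 𝓝 x, ∃ᶠ k : ℕ in atTop, Φ k x ∈ O := by
  have hξc (i) := (hξ i).continuous
  have hηc (j) := (hη j).continuous
  choose R hR0 hR using exists_energy_clampComp hξc hηc hξm hηm hc hd
  set H := energy ξ η c d
  set V := hamiltonianField B ξ η
  set HR := fun h => energy (fun i => clampComp (R h) (ξ i)) (fun j => clampComp (R h) (η j)) c d
  set VR := fun h => hamiltonianField B (fun i => clampComp (R h) (ξ i))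
    (fun j => clampComp (R h) (η j))
  have hHc : Continuous H := continuous_energy hξc hηc
  have hHz {z} (hz : IsTrajectory V z) (t : ℝ) : H (z t) = H (z 0) :=
    energy_eq_of_isTrajectory hξc hηc hz t
  have hHRz {h z} (hz : IsTrajectory (VR h) z) (t : ℝ) : HR h (z t) = HR h (z 0) :=
    energy_eq_of_isTrajectory (fun i => continuous_clampComp (hξc i))
      (fun j => continuous_clampComp (hηc j)) hz t
  have hsub {h x} : H x ≤ h ↔ HR h x ≤ h :=
    ⟨fun hx => (hR h x (.inr hx)).2.trans_le hx, fun hx => (hR h x (.inl hx)).2.symm.trans_le hx⟩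
  have hVR {h x} (hx : H x ≤ h) : VR h x = V x := hamiltonianField_clampComp (hR h x (.inr hx)).1
  -- Trajectories of energy at most `h` are the same for the two fields.
  have htoVR {h z} (hz : IsTrajectory V z) (h0 : H (z 0) ≤ h) : IsTrajectory (VR h) z :=
    fun t => by
      rw [hVR ((hHz hz t).trans_le h0)]
      exact hz t
  have htoV {h z} (hz : IsTrajectory (VR h) z) (h0 : H (z 0) ≤ h) : IsTrajectory V z :=
    fun t => by
      rw [← hVR (hsub.2 ((hHRz hz t).trans_le (hsub.1 h0)))]
      exact hz t
  have hPQ (h) : ∃ K C : NNReal,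
      LipschitzWith K (fun w : J → ℝ => (-B).mulVec fun j => clampComp (R h) (η j) (w j)) ∧
      LipschitzWith K (fun u : I → ℝ => B.transpose.mulVec fun i => clampComp (R h) (ξ i) (u i)) ∧
      (∀ w : J → ℝ, ‖(-B).mulVec fun j => clampComp (R h) (η j) (w j)‖ ≤ C) ∧
      ∀ u : I → ℝ, ‖B.transpose.mulVec fun i => clampComp (R h) (ξ i) (u i)‖ ≤ C := by
    obtain ⟨K₁, C₁, hK₁, hC₁⟩ := exists_lipschitzWith_mulVec_clampComp (hR0 h) (-B) hη
    obtain ⟨K₂, C₂, hK₂, hC₂⟩ := exists_lipschitzWith_mulVec_clampComp (hR0 h) B.transpose hξ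
    exact ⟨max K₁ K₂, max C₁ C₂, hK₁.weaken (le_max_left _ _), hK₂.weaken (le_max_right _ _),
      fun w => (hC₁ w).trans (by simp), fun u => (hC₂ u).trans (by simp)⟩
  choose K C hP hQ hPC hQC using hPQ
  have hVlip (h) : LipschitzWith (K h) (VR h) := lipschitzWith_separableField (hP h) (hQ h)
  have hVbd (h x) : ‖VR h x‖ ≤ C h := norm_separableField_le (hPC h) (hQC h) x
  obtain ⟨Φ, hΦ⟩ : ∃ Φ : Flow ℝ ((I → ℝ) × (J → ℝ)), ∀ x, IsTrajectory V fun t => Φ t x := by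
    refine exists_flow_of_forall_exists_isTrajectory (locallyLipschitz_hamiltonianField hξ hη)
      (fun x => ?_) fun x => ?_
    · obtain ⟨z, hz0, hz⟩ := exists_isTrajectory_of_lipschitz_of_bounded (hVlip (H x)) (hVbd _) x
      exact ⟨z, hz0, htoV hz (by rw [hz0])⟩
    · exact ⟨{y | H y < H x + 1}, (isOpen_lt hHc continuous_const).mem_nhds (lt_add_one (H x)),
        K (H x + 1), VR (H x + 1), hVlip _, fun z hz0 hz => htoVR hz (le_of_lt hz0)⟩
  have hHΦ (x t) : H (Φ t x) = H x := by simpa using hHz (hΦ x) t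
  refine ⟨Φ, hΦ, fun x => ?_, ?_⟩
  · refine (Metric.isBounded_closedBall (x := 0) (r := R (H x))).subset ?_
    rintro _ ⟨t, rfl⟩
    exact mem_closedBall_zero_iff.2 (hR (H x) _ (.inr (hHΦ x t).le)).1
  · have hrec (h : ℕ) : ∀ᵐ x, H x ≤ h → ∀ O ∈ 𝓝 x, ∃ᶠ k : ℕ in atTop, Φ k x ∈ O := by
      obtain ⟨Ψ, hΨ⟩ := exists_flow_of_lipschitz_of_bounded (hVlip h) (hVbd h)
      set S := {x | H x ≤ h}
      have hSm : MeasurableSet S := (isClosed_le hHc continuous_const).measurableSet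
      have hSf : volume S < ⊤ :=
        (Metric.isBounded_closedBall (x := 0) (r := R h)).subset (fun _ hx =>
          mem_closedBall_zero_iff.2 (hR h _ (.inr hx)).1) |>.measure_lt_top
      have hpre : Ψ 1 ⁻¹' S = S := by
        ext x
        have : HR h (Ψ 1 x) = HR h x := by simpa using hHRz (hΨ x) 1
        exact hsub.trans (this ▸ hsub.symm)
      have hmp := (measurePreserving_flow_one (hP h) (hQ h) (hPC h) (hQC h) hΨ).restrict_preimage
        hSm
      rw [hpre] at hmp
      have : IsFiniteMeasure (volume.restrict S) := ⟨by simpa using hSf⟩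
      have hae := hmp.conservative.ae_frequently_mem_of_mem_nhds
      rw [ae_restrict_iff' hSm] at hae
      filter_upwards [hae] with x hx hxS O hO
      refine (hx hxS O hO).mono fun k hk => ?_
      have hiter : (Ψ 1)^[k] x = Ψ k x := by
        clear hk
        induction k with
        | zero => simp
        | succ k ih => rw [Function.iterate_succ_apply', ih, ← Ψ.map_add]; push_cast; ring_nf
      have heq : (fun t => Ψ t x) = fun t => Φ t x :=
        IsTrajectory.eq_of_apply_eq (hVlip h).locallyLipschitz (hΨ x)
          (htoVR (hΦ x) (by simpa using hxS)) (t₀ := 0) (by simp)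
      rw [← congrFun heq k, ← hiter]
      exact hk
    filter_upwards [ae_all_iff.2 hrec] with x hx
    obtain ⟨h, hh⟩ := exists_nat_ge (H x)
    exact hx h hh

end Hamiltonian

/-! ### Gradient ascent curves -/

section GradientCurve

theorem contDiff_gradient {d : ℕ} {k : EuclideanSpace ℝ (Fin d) → ℝ} {n m : WithTop ℕ∞}
    (hk : ContDiff ℝ n k) (hmn : m + 1 ≤ n) : ContDiff ℝ m (gradient k) :=
  (InnerProductSpace.toDual ℝ (EuclideanSpace ℝ (Fin d))).symm.contDiff.comp
    (hk.fderiv_right hmn)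

variable {E : Type*} [NormedAddCommGroup E] [NormedSpace ℝ E]

/-- Trajectories gain one derivative over the vector field. -/
theorem IsTrajectory.contDiff {r : ℕ∞} {V : E → E} {z : ℝ → E} (hz : IsTrajectory V z)
    (hV : ∀ n : ℕ, n + 1 ≤ r → ContDiff ℝ n V) : ContDiff ℝ r z := by
  have hn (n : ℕ) (hn : n ≤ r) : ContDiff ℝ n z := by
    induction n with
    | zero => exact contDiff_zero.2 hz.continuous
    | succ n ih =>
      have hderiv : deriv z = V ∘ z := funext fun t => (hz t).deriv
      push_cast at hn ⊢
      refine contDiff_succ_iff_deriv.2 ⟨fun t => (hz t).differentiableAt, by simp, ?_⟩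
      rw [hderiv]
      exact (hV n hn).comp (ih (le_self_add.trans hn))
  induction r using ENat.recTopCoe with
  | top => exact contDiff_infty.2 fun n => hn n le_top
  | coe r => exact hn r le_rfl

variable {d : ℕ} {k : EuclideanSpace ℝ (Fin d) → ℝ} {x₀ : EuclideanSpace ℝ (Fin d)}

theorem gradientOrbit_eq_range (hk : LocallyLipschitz (gradient k))
    {γ : ℝ → EuclideanSpace ℝ (Fin d)} (hγ : IsTrajectory (gradient k) γ) (h0 : γ 0 = x₀) :
    gradientOrbit k x₀ = range γ := by
  ext x
  constructor
  · rintro ⟨δ, a, b, t, ha, hb, hδ0, hδ, ht, rfl⟩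
    exact ⟨t, eqOn_of_hasDerivAt_of_locallyLipschitz hk isOpen_Ioo isPreconnected_Ioo
      (t₀ := 0) ⟨ha, hb⟩ (fun s _ => hγ s) hδ (by rw [h0, hδ0]) ht⟩
  · rintro ⟨t, rfl⟩
    exact ⟨γ, -(|t| + 1), |t| + 1, t, by linarith [abs_nonneg t], by positivity, h0,
      fun s _ => hγ s, abs_lt.1 (lt_add_one |t|), rfl⟩

theorem hasDerivAt_comp_gradientCurve (hk : Differentiable ℝ k)
    {γ : ℝ → EuclideanSpace ℝ (Fin d)} (hγ : IsTrajectory (gradient k) γ) (t : ℝ) :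
    HasDerivAt (fun t => k (γ t)) (‖gradient k (γ t)‖ ^ 2) t := by
  have := (hk (γ t)).hasGradientAt.hasFDerivAt.comp_hasDerivAt t (hγ t)
  refine this.congr_deriv ?_
  rw [InnerProductSpace.toDual_apply_apply, real_inner_self_eq_norm_sq]

/-- Along a gradient ascent curve `γ` the time is the integral of `1 / ‖∇k‖²` with respect to the
value of `k`. With the time origin shifted to the point where `k = p`, the coordinate `reparam`
is therefore the time, and its inverse is `k ∘ γ`. -/
theorem exists_gradientCurve {r : ℕ∞} (hr : 2 ≤ r) (hk : ContDiff ℝ r k)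
    (hcomplete : GradientComplete k x₀) (hx₀ : gradient k x₀ ≠ 0) {p : ℝ}
    (hp : p ∈ attainable k x₀) :
    ∃ (γ : ℝ → EuclideanSpace ℝ (Fin d)) (a₀ : ℝ), ContDiff ℝ r γ ∧
      IsTrajectory (gradient k) γ ∧ γ a₀ = x₀ ∧ k (γ 0) = p ∧ StrictMono (fun a => k (γ a)) ∧
      attainable k x₀ = range (fun a => k (γ a)) ∧ IsOpen (attainable k x₀) ∧
      ContDiffOn ℝ r (reparam k x₀ p) (attainable k x₀) ∧
      (∀ a, reparam k x₀ p (k (γ a)) = a) ∧ ∀ a, reparamInv k x₀ p a = k (γ a) := by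
  have hr' : (2 : WithTop ℕ∞) ≤ (r : WithTop ℕ∞) := WithTop.coe_le_coe.2 hr
  have hgrad1 : ContDiff ℝ 1 (gradient k) :=
    contDiff_gradient hk (by rwa [one_add_one_eq_two])
  have hlip := hgrad1.locallyLipschitz
  have hdiff : Differentiable ℝ k := hk.differentiable (by rintro h; simp [h] at hr')
  obtain ⟨δ, hδ0, hδ⟩ := hcomplete
  obtain ⟨y, hy, hyp⟩ := hp
  rw [gradientOrbit_eq_range hlip hδ hδ0] at hy
  obtain ⟨τ, rfl⟩ := hy
  set γ : ℝ → EuclideanSpace ℝ (Fin d) := fun a => δ (a + τ) with hγdef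
  have hγ : IsTrajectory (gradient k) γ := IsTrajectory.comp_add hδ τ
  have hγ0 : k (γ 0) = p := by simpa [hγdef] using hyp
  have hγx : γ (-τ) = x₀ := by simpa [hγdef] using hδ0
  have hrange : gradientOrbit k x₀ = range γ := by
    rw [gradientOrbit_eq_range hlip hδ hδ0]
    exact ((Equiv.addRight τ).surjective.range_comp δ).symm
  have hγr : ContDiff ℝ r γ := hγ.contDiff fun n hn =>
    contDiff_gradient hk (by exact_mod_cast hn)
  -- A stationary point on the curve would make the whole curve constant.
  have hne (a : ℝ) : gradient k (γ a) ≠ 0 := fun h => by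
    have hconst : IsTrajectory (gradient k) fun _ => γ a := fun t => by
      rw [h]; exact hasDerivAt_const t _
    have := congrFun (IsTrajectory.eq_of_apply_eq hlip hγ hconst (t₀ := a) rfl) (-τ)
    exact hx₀ (by rw [← hγx, this, h])
  set φ : ℝ → ℝ := fun a => k (γ a)
  have hφder (a : ℝ) : HasDerivAt φ (‖gradient k (γ a)‖ ^ 2) a :=
    hasDerivAt_comp_gradientCurve hdiff hγ a
  have hφr : ContDiff ℝ r φ := hk.comp hγr
  have hφpos (a : ℝ) : 0 < ‖gradient k (γ a)‖ ^ 2 := by have := norm_pos_iff.2 (hne a); positivity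
  have hmono : StrictMono φ :=
    strictMono_of_deriv_pos fun a => by rw [(hφder a).deriv]; exact hφpos a
  have hatt : attainable k x₀ = range φ := by
    rw [attainable, hrange, ← range_comp]
    rfl
  have hstrict (a : ℝ) : HasStrictDerivAt φ (‖gradient k (γ a)‖ ^ 2) a :=
    hφr.contDiffAt.hasStrictDerivAt' (hφder a) (by rintro h; simp [h] at hr')
  have hopen : IsOpenEmbedding φ := .of_continuous_injective_isOpenMap hφr.continuous
    hmono.injective (isOpenMap_of_hasStrictDerivAt hstrict fun a => (hφpos a).ne')
  set e := hopen.toOpenPartialHomeomorph φ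
  have heφ (a : ℝ) : e.symm (φ a) = a := hopen.toOpenPartialHomeomorph_left_inv φ
  have htarget : e.target = range φ := hopen.toOpenPartialHomeomorph_target φ
  have horbit (a : ℝ) : orbitPoint k x₀ (φ a) = γ a := by
    have hex : ∃ x ∈ gradientOrbit k x₀, k x = φ a := ⟨γ a, by rw [hrange]; exact ⟨a, rfl⟩, rfl⟩
    have hmem := Function.invFunOn_mem hex
    have hval := Function.invFunOn_eq hex
    obtain ⟨b, hb⟩ := hrange.subset hmem
    rw [← hb] at hval
    rw [orbitPoint, ← hb, hmono.injective hval]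
  have hsymm (a : ℝ) : HasDerivAt e.symm (1 / ‖gradient k (orbitPoint k x₀ (φ a))‖ ^ 2) (φ a) := by
    rw [horbit, one_div]
    refine e.hasDerivAt_symm (by rw [htarget]; exact ⟨a, rfl⟩) (hφpos a).ne' ?_
    rw [heφ]
    exact hφder a
  have hsymmr : ContDiffOn ℝ r e.symm (range φ) := by
    rintro _ ⟨a, rfl⟩
    refine (e.contDiffAt_symm_deriv (hφpos a).ne' (by rw [htarget]; exact ⟨a, rfl⟩) ?_ ?_)
      |>.contDiffWithinAt
    · rw [heφ]; exact hφder a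
    · exact hφr.contDiffAt
  have hreparam (a : ℝ) : reparam k x₀ p (φ a) = a := by
    have hsub : uIcc p (φ a) ⊆ range φ := by
      rw [← hγ0]
      exact (isPreconnected_range hφr.continuous).ordConnected.uIcc_subset ⟨0, rfl⟩ ⟨a, rfl⟩
    have hder : ∀ z ∈ uIcc p (φ a),
        HasDerivAt e.symm (1 / ‖gradient k (orbitPoint k x₀ z)‖ ^ 2) z := fun z hz => by
      obtain ⟨b, rfl⟩ := hsub hz
      exact hsymm b
    have hcont : ContinuousOn (fun z => 1 / ‖gradient k (orbitPoint k x₀ z)‖ ^ 2)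
        (uIcc p (φ a)) := by
      have : ContinuousOn (fun z => 1 / ‖gradient k (γ (e.symm z))‖ ^ 2) (range φ) := by
        refine continuousOn_const.div ?_ fun z _ => (hφpos _).ne'
        exact ((hgrad1.continuous.comp hγr.continuous).norm.pow 2).comp_continuousOn
          hsymmr.continuousOn
      refine (this.mono hsub).congr fun z hz => ?_
      obtain ⟨b, rfl⟩ := hsub hz
      simp only [heφ, horbit]
    have := intervalIntegral.integral_eq_sub_of_hasDerivAt hder hcont.intervalIntegrable
    rw [reparam, this, heφ, ← hγ0, heφ, sub_zero]
  refine ⟨γ, -τ, hγr, hγ, hγx, hγ0, hmono, hatt, ?_, ?_, hreparam, fun a => ?_⟩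
  · rw [hatt]; exact hopen.isOpen_range
  · rw [hatt]
    refine hsymmr.congr ?_
    rintro _ ⟨a, rfl⟩
    rw [hreparam, heφ]
  · have hex : ∃ y ∈ attainable k x₀, reparam k x₀ p y = a :=
      ⟨φ a, by rw [hatt]; exact ⟨a, rfl⟩, hreparam a⟩
    have hmem := Function.invFunOn_mem hex
    have hval := Function.invFunOn_eq hex
    obtain ⟨b, hb⟩ := hatt.subset hmem
    rw [← hb, hreparam] at hval
    rw [reparamInv, ← hb, hval]

theorem isDiffeoBetween_reparam {r : ℕ∞} {p : ℝ} {φ : ℝ → ℝ} (hφ : ContDiff ℝ r φ)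
    (hatt : attainable k x₀ = range φ) (hopen : IsOpen (attainable k x₀))
    (hr : ContDiffOn ℝ r (reparam k x₀ p) (attainable k x₀))
    (hinv : ∀ a, reparam k x₀ p (φ a) = a) :
    IsDiffeoBetween r (reparam k x₀ p) (attainable k x₀) univ := by
  refine ⟨mapsTo_univ _ _, ⟨_, hopen, Subset.rfl, hr⟩, φ, fun a _ => ?_, ⟨fun y hy => ?_,
    fun a _ => hinv a⟩, univ, isOpen_univ, Subset.rfl, hφ.contDiffOn⟩
  · rw [hatt]; exact ⟨a, rfl⟩
  · rw [hatt] at hy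
    obtain ⟨a, rfl⟩ := hy
    rw [hinv]

end GradientCurve

/-! ### Linear changes of coordinates, divergence and recurrence -/

section Conjugation

variable {E F : Type*} [NormedAddCommGroup E] [NormedSpace ℝ E]
  [NormedAddCommGroup F] [NormedSpace ℝ F]

theorem divergence_separableField [FiniteDimensional ℝ E] [FiniteDimensional ℝ F] {P : F → E}
    {Q : E → F} (hP : Differentiable ℝ P) (hQ : Differentiable ℝ Q) (x : E × F) :
    divergence (separableField P Q) x = 0 := by
  have h : HasFDerivAt (separableField P Q)
      (((fderiv ℝ P x.2).comp (ContinuousLinearMap.snd ℝ E F)).prod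
        ((fderiv ℝ Q x.1).comp (ContinuousLinearMap.fst ℝ E F))) x :=
    ((hP x.2).hasFDerivAt.comp x hasFDerivAt_snd).prodMk
      ((hQ x.1).hasFDerivAt.comp x hasFDerivAt_fst)
  set A : E × F →ₗ[ℝ] E := (fderiv ℝ P x.2 : F →ₗ[ℝ] E) ∘ₗ LinearMap.snd ℝ E F
  set B : E × F →ₗ[ℝ] F := (fderiv ℝ Q x.1 : E →ₗ[ℝ] F) ∘ₗ LinearMap.fst ℝ E F
  have hA : A ∘ₗ LinearMap.inl ℝ E F = 0 := by ext; simp [A]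
  have hB : B ∘ₗ LinearMap.inr ℝ E F = 0 := by ext; simp [B]
  have hAB : (fderiv ℝ (separableField P Q) x : E × F →ₗ[ℝ] E × F) =
      LinearMap.inl ℝ E F ∘ₗ A + LinearMap.inr ℝ E F ∘ₗ B := by
    rw [h.fderiv]
    ext <;> simp [A, B]
  rw [divergence, hAB, map_add, LinearMap.trace_comp_comm' A, LinearMap.trace_comp_comm' B,
    hA, hB, map_zero, map_zero, add_zero]

theorem divergence_conj (L : E ≃L[ℝ] F) {W : F → F} (hW : Differentiable ℝ W) (x : E) :
    divergence (fun x => L.symm (W (L x))) x = divergence W (L x) := by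
  have h := L.symm.hasFDerivAt.comp x ((hW (L x)).hasFDerivAt.comp x L.hasFDerivAt)
  have h' : fderiv ℝ (fun x => L.symm (W (L x))) x = _ := h.fderiv
  rw [divergence, h', divergence, ← LinearMap.trace_conj' _ L.symm.toLinearEquiv]
  rfl

/-- The flow `L⁻¹ ∘ Φ ∘ L`. -/
noncomputable def conjFlow (L : E ≃L[ℝ] F) (Φ : Flow ℝ F) : Flow ℝ E where
  toFun t x := L.symm (Φ t (L x))
  cont' := L.symm.continuous.comp (Φ.continuous continuous_fst (L.continuous.comp continuous_snd))
  map_add' s t x := by simp [Φ.map_add]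
  map_zero' x := by simp

theorem isTrajectory_conjFlow (L : E ≃L[ℝ] F) {Φ : Flow ℝ F} {W : F → F}
    (hΦ : ∀ y, IsTrajectory W fun t => Φ t y) (x : E) :
    IsTrajectory (fun x => L.symm (W (L x))) fun t => conjFlow L Φ t x := by
  intro t
  have := (L.symm : F →L[ℝ] E).hasFDerivAt.comp_hasDerivAt t (hΦ (L x) t)
  simpa [conjFlow, Function.comp_def] using this

theorem isBounded_range_conjFlow (L : E ≃L[ℝ] F) {Φ : Flow ℝ F}
    (hΦ : ∀ y, Bornology.IsBounded (range fun t => Φ t y)) (x : E) :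
    Bornology.IsBounded (range fun t => conjFlow L Φ t x) := by
  have := (L.symm : F →L[ℝ] E).lipschitz.isBounded_image (hΦ (L x))
  rwa [← range_comp] at this

theorem isRecurrentPoint_of_frequently {X : Type*} [TopologicalSpace X] {Ψ : Flow ℝ X} {x : X}
    (h : ∀ O ∈ 𝓝 x, ∃ᶠ k : ℕ in atTop, Ψ k x ∈ O) : IsRecurrentPoint Ψ x := by
  intro O hO
  obtain ⟨s, hs, hsO⟩ := extraction_of_frequently_atTop (h O hO)
  exact ⟨fun k => s k, fun _ _ hab => Nat.cast_lt.2 (hs hab),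
    tendsto_natCast_atTop_atTop.comp hs.tendsto_atTop, hsO⟩

variable [FiniteDimensional ℝ E] [MeasureSpace E] [BorelSpace E] [MeasureSpace F] [BorelSpace F]
  [(volume : Measure E).IsAddHaarMeasure] [(volume : Measure F).IsAddHaarMeasure]

theorem isAddHaarMeasure_volume_prod [FiniteDimensional ℝ F] :
    (volume : Measure (E × F)).IsAddHaarMeasure :=
  inferInstanceAs ((volume : Measure E).prod (volume : Measure F)).IsAddHaarMeasure

/-- A linear isomorphism preserves null sets, hence Poincaré recurrence. -/
theorem isPoincareRecurrentOn_conjFlow (L : E ≃L[ℝ] F) {Φ : Flow ℝ F}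
    (hΦ : ∀ᵐ y, ∀ O ∈ 𝓝 y, ∃ᶠ k : ℕ in atTop, Φ k y ∈ O) :
    IsPoincareRecurrentOn (conjFlow L Φ) univ := by
  have : FiniteDimensional ℝ F := L.toLinearEquiv.finiteDimensional
  refine ⟨by simp [NeZero.ne], ?_⟩
  have hL : Measure.QuasiMeasurePreserving L (volume : Measure E) volume := by
    have := L.isAddHaarMeasure_map (volume : Measure E)
    exact ⟨L.continuous.measurable, Measure.absolutelyContinuous_isAddHaarMeasure _ _⟩
  have hae : ∀ᵐ x : E, IsRecurrentPoint (conjFlow L Φ) x := by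
    filter_upwards [hL.ae hΦ] with x hx
    refine isRecurrentPoint_of_frequently fun O hO => ?_
    have hO' : L.symm ⁻¹' O ∈ 𝓝 (L x) :=
      L.symm.continuous.continuousAt.preimage_mem_nhds (by simpa using hO)
    exact hx _ hO'
  simpa [ae_iff] using hae

end Conjugation

/-! ### The reduced system as a separable Hamiltonian system -/

section Reduced

variable {N M : ℕ}

/-- At a fully mixed equilibrium all pure strategies of both players have the same payoff. -/
theorem IsFullyMixedNash.exists_value {U : Matrix (Fin N) (Fin M) ℝ} {p : Fin N → ℝ}
    {q : Fin M → ℝ} (h : IsFullyMixedNash U p q) :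
    ∃ v, (∀ i, ∑ j, U i j * q j = v) ∧ ∀ j, ∑ i, U i j * p i = v := by
  set v := p ⬝ᵥ U.mulVec q with hv
  have hp1 : ∑ i, p i = 1 := h.p_mem.2
  have hq1 : ∑ j, q j = 1 := h.q_mem.2
  have hrow (i) : v ≤ U.mulVec q i := by
    simpa using h.p_opt _ (single_mem_stdSimplex ℝ i)
  have hcol (j) : Matrix.vecMul p U j ≤ v := by
    have := h.q_opt _ (single_mem_stdSimplex ℝ j)
    rwa [Matrix.dotProduct_mulVec, dotProduct_single_one] at this
  have hprow : ∑ i, p i * (U.mulVec q i - v) = 0 := by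
    simp only [mul_sub, Finset.sum_sub_distrib, ← Finset.sum_mul, hp1, one_mul]
    exact sub_self _
  have hqcol : ∑ j, q j * (v - Matrix.vecMul p U j) = 0 := by
    simp only [mul_sub, Finset.sum_sub_distrib, ← Finset.sum_mul, hq1, one_mul]
    rw [hv, Matrix.dotProduct_mulVec, dotProduct_comm]
    exact sub_self _
  rw [Finset.sum_eq_zero_iff_of_nonneg
    fun i _ => mul_nonneg (h.p_pos i).le (sub_nonneg.2 (hrow i))] at hprow
  rw [Finset.sum_eq_zero_iff_of_nonneg
    fun j _ => mul_nonneg (h.q_pos j).le (sub_nonneg.2 (hcol j))] at hqcol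
  refine ⟨v, fun i => ?_, fun j => ?_⟩
  · have := (mul_eq_zero.1 (hprow i (Finset.mem_univ i))).resolve_left (h.p_pos i).ne'
    exact sub_eq_zero.1 this
  · have := (mul_eq_zero.1 (hqcol j (Finset.mem_univ j))).resolve_left (h.q_pos j).ne'
    rw [sub_eq_zero.1 this]
    simp [Matrix.vecMul, dotProduct, mul_comm]

/-- The splitting of the reduced state into the blocks `(a, μ)` and `(b, λ)`, each of which
evolves with a velocity that depends on the other block only. -/
noncomputable def blockEquiv (N M : ℕ) :
    Reduced N M ≃L[ℝ] (Fin N ⊕ Unit → ℝ) × (Fin M ⊕ Unit → ℝ) :=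
  LinearEquiv.toContinuousLinearEquiv
    { toFun := fun x => (Sum.elim x.1 fun _ => x.2.2.2, Sum.elim x.2.1 fun _ => x.2.2.1)
      invFun := fun y => (fun i => y.1 (.inl i), fun j => y.2 (.inl j), y.2 (.inr ()), y.1 (.inr ()))
      map_add' := fun x y => by
        ext k <;> rcases k with k | k <;> rfl
      map_smul' := fun c x => by
        ext k <;> rcases k with k | k <;> rfl
      left_inv := fun x => rfl
      right_inv := fun y => by
        ext k <;> rcases k with k | k <;> rfl }

variable {n : Fin N → ℕ} {m : Fin M → ℕ}
  {f : ∀ i, EuclideanSpace ℝ (Fin (n i)) → ℝ} {g : ∀ j, EuclideanSpace ℝ (Fin (m j)) → ℝ}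
  {U : Matrix (Fin N) (Fin M) ℝ} {p : Fin N → ℝ} {q : Fin M → ℝ} {x₀ : State n m}

/-- The forces on the block `(a, μ)`: the deviations of the strategy of the minimizer from `p`,
and the multiplier `μ` measured from its equilibrium value `-v`. -/
noncomputable def rowForce (f : ∀ i, EuclideanSpace ℝ (Fin (n i)) → ℝ) (p : Fin N → ℝ)
    (x₀ : State n m) (v : ℝ) : Fin N ⊕ Unit → ℝ → ℝ :=
  Sum.elim (fun i s => reparamInv (f i) (x₀.1 i) (p i) s - p i) (fun _ s => s + v)

/-- The forces on the block `(b, λ)`: the deviations of the strategy of the maximizer from `q`,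
and the multiplier `λ` measured from its equilibrium value `-v`. -/
noncomputable def colForce (g : ∀ j, EuclideanSpace ℝ (Fin (m j)) → ℝ) (q : Fin M → ℝ)
    (x₀ : State n m) (v : ℝ) : Fin M ⊕ Unit → ℝ → ℝ :=
  Sum.elim (fun j s => reparamInv (g j) (x₀.2.1 j) (q j) s - q j) (fun _ s => s + v)

/-- The payoff matrix bordered by ones, which couples the two blocks of the reduced system. -/
def borderedMatrix (U : Matrix (Fin N) (Fin M) ℝ) : Matrix (Fin N ⊕ Unit) (Fin M ⊕ Unit) ℝ :=
  Matrix.fromBlocks U (.of fun _ _ => 1) (.of fun _ _ => 1) 0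

theorem reducedField_eq_conj {v : ℝ} (hp : ∑ i, p i = 1) (hq : ∑ j, q j = 1)
    (hrow : ∀ i, ∑ j, U i j * q j = v) (hcol : ∀ j, ∑ i, U i j * p i = v) :
    reducedField f g U p q x₀ = fun x => (blockEquiv N M).symm
      (hamiltonianField (borderedMatrix U) (rowForce f p x₀ v) (colForce g q x₀ v)
        (blockEquiv N M x)) := by
  funext ⟨a, b, lam, mu⟩
  refine Prod.ext (funext fun i => ?_) (Prod.ext (funext fun j => ?_) (Prod.ext ?_ ?_))
  · change _ = (-borderedMatrix U).mulVec (fun j => colForce g q x₀ v j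
      (Sum.elim b (fun _ => lam) j)) (.inl i)
    simp [reducedField, Matrix.mulVec, dotProduct, borderedMatrix, colForce, mul_sub, hrow,
      Finset.sum_neg_distrib, Matrix.fromBlocks_apply₁₁, Matrix.fromBlocks_apply₁₂]
  · change _ = (borderedMatrix U).transpose.mulVec (fun i => rowForce f p x₀ v i
      (Sum.elim a (fun _ => mu) i)) (.inl j)
    simp [reducedField, Matrix.mulVec, dotProduct, borderedMatrix, rowForce, mul_sub, hcol,
      Matrix.fromBlocks_apply₁₁, Matrix.fromBlocks_apply₂₁]
  · change _ = (borderedMatrix U).transpose.mulVec (fun i => rowForce f p x₀ v i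
      (Sum.elim a (fun _ => mu) i)) (.inr ())
    simp [reducedField, Matrix.mulVec, dotProduct, borderedMatrix, rowForce, hp,
      Matrix.fromBlocks_apply₁₂, Matrix.fromBlocks_apply₂₂]
  · change _ = (-borderedMatrix U).mulVec (fun j => colForce g q x₀ v j
      (Sum.elim b (fun _ => lam) j)) (.inr ())
    simp [reducedField, Matrix.mulVec, dotProduct, borderedMatrix, colForce, hq,
      Matrix.fromBlocks_apply₂₁, Matrix.fromBlocks_apply₂₂]

theorem contDiff_reducedField {r : WithTop ℕ∞}
    (hX : ∀ i, ContDiff ℝ r (reparamInv (f i) (x₀.1 i) (p i)))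
    (hY : ∀ j, ContDiff ℝ r (reparamInv (g j) (x₀.2.1 j) (q j))) :
    ContDiff ℝ r (reducedField f g U p q x₀) := by
  have h1 (i) : ContDiff ℝ r fun x : Reduced N M => reparamInv (f i) (x₀.1 i) (p i) (x.1 i) :=
    (hX i).comp ((contDiff_apply ℝ ℝ i).comp contDiff_fst)
  have h2 (j) : ContDiff ℝ r fun x : Reduced N M => reparamInv (g j) (x₀.2.1 j) (q j) (x.2.1 j) :=
    (hY j).comp ((contDiff_apply ℝ ℝ j).comp (contDiff_fst.comp contDiff_snd))
  have h3 : ContDiff ℝ r fun x : Reduced N M => x.2.2.1 :=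
    contDiff_fst.comp (contDiff_snd.comp contDiff_snd)
  have h4 : ContDiff ℝ r fun x : Reduced N M => x.2.2.2 :=
    contDiff_snd.comp (contDiff_snd.comp contDiff_snd)
  have ha (i) : ContDiff ℝ r fun x => (reducedField f g U p q x₀ x).1 i :=
    ((ContDiff.sum fun j _ => contDiff_const.mul (h2 j)).add h3).neg
  have hb (j) : ContDiff ℝ r fun x => (reducedField f g U p q x₀ x).2.1 j :=
    (ContDiff.sum fun i _ => contDiff_const.mul (h1 i)).add h4
  exact (contDiff_pi.2 ha).prodMk ((contDiff_pi.2 hb).prodMk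
    (((ContDiff.sum fun i _ => h1 i).sub contDiff_const).prodMk
      ((ContDiff.sum fun j _ => h2 j).sub contDiff_const).neg))

theorem divergence_reducedField (hpq : IsFullyMixedNash U p q)
    (hX : ∀ i, ContDiff ℝ 1 (reparamInv (f i) (x₀.1 i) (p i)))
    (hY : ∀ j, ContDiff ℝ 1 (reparamInv (g j) (x₀.2.1 j) (q j))) (y : Reduced N M) :
    divergence (reducedField f g U p q x₀) y = 0 := by
  obtain ⟨v, hrow, hcol⟩ := hpq.exists_value
  have hξ (i) : Differentiable ℝ (rowForce f p x₀ v i) := by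
    rcases i with i | i
    · exact ((hX i).differentiable one_ne_zero).sub_const _
    · exact differentiable_id.add_const v
  have hη (j) : Differentiable ℝ (colForce g q x₀ v j) := by
    rcases j with j | j
    · exact ((hY j).differentiable one_ne_zero).sub_const _
    · exact differentiable_id.add_const v
  have hP : Differentiable ℝ fun w : Fin M ⊕ Unit → ℝ =>
      (-borderedMatrix U).mulVec fun j => colForce g q x₀ v j (w j) := by
    refine differentiable_pi.2 fun i => ?_
    simp only [Matrix.mulVec, dotProduct]
    fun_prop
  have hQ : Differentiable ℝ fun u : Fin N ⊕ Unit → ℝ =>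
      (borderedMatrix U).transpose.mulVec fun i => rowForce f p x₀ v i (u i) := by
    refine differentiable_pi.2 fun i => ?_
    simp only [Matrix.mulVec, dotProduct]
    fun_prop
  have hW : Differentiable ℝ
      (hamiltonianField (borderedMatrix U) (rowForce f p x₀ v) (colForce g q x₀ v)) :=
    (hP.comp differentiable_snd).prodMk (hQ.comp differentiable_fst)
  rw [reducedField_eq_conj hpq.p_mem.2 hpq.q_mem.2 hrow hcol, divergence_conj _ hW]
  exact divergence_separableField hP hQ _

theorem exists_flow_reducedField (hpq : IsFullyMixedNash U p q)
    (hX : ∀ i, ContDiff ℝ 1 (reparamInv (f i) (x₀.1 i) (p i)))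
    (hY : ∀ j, ContDiff ℝ 1 (reparamInv (g j) (x₀.2.1 j) (q j)))
    (hXm : ∀ i, StrictMono (reparamInv (f i) (x₀.1 i) (p i)))
    (hYm : ∀ j, StrictMono (reparamInv (g j) (x₀.2.1 j) (q j)))
    (hX0 : ∀ i, reparamInv (f i) (x₀.1 i) (p i) 0 = p i)
    (hY0 : ∀ j, reparamInv (g j) (x₀.2.1 j) (q j) 0 = q j) :
    ∃ Ψ : Flow ℝ (Reduced N M),
      (∀ y, IsTrajectory (reducedField f g U p q x₀) (fun t => Ψ t y)) ∧
      (∀ y, Bornology.IsBounded (range fun t => Ψ t y)) ∧ IsPoincareRecurrentOn Ψ univ := by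
  obtain ⟨v, hrow, hcol⟩ := hpq.exists_value
  have hid : StrictMono fun s : ℝ => s + v := fun _ _ h => add_lt_add_left h v
  obtain ⟨Φ, hΦ, hb, hrec⟩ := exists_flow_hamiltonianField (borderedMatrix U)
    (ξ := rowForce f p x₀ v) (η := colForce g q x₀ v)
    (c := Sum.elim (fun _ => 0) fun _ => -v) (d := Sum.elim (fun _ => 0) fun _ => -v)
    (by rintro (i | i); exacts [(hX i).sub contDiff_const, contDiff_id.add contDiff_const])
    (by rintro (j | j); exacts [(hY j).sub contDiff_const, contDiff_id.add contDiff_const])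
    (by rintro (i | i); exacts [fun _ _ h => sub_lt_sub_right (hXm i h) _, hid])
    (by rintro (j | j); exacts [fun _ _ h => sub_lt_sub_right (hYm j h) _, hid])
    (by rintro (i | i) <;> simp [rowForce, hX0]) (by rintro (j | j) <;> simp [colForce, hY0])
  have h1 : (volume : Measure (ℝ × ℝ)).IsAddHaarMeasure := isAddHaarMeasure_volume_prod
  have h2 : (volume : Measure ((Fin M → ℝ) × ℝ × ℝ)).IsAddHaarMeasure :=
    isAddHaarMeasure_volume_prod
  have h3 : (volume : Measure (Reduced N M)).IsAddHaarMeasure := isAddHaarMeasure_volume_prod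
  have h4 : (volume : Measure ((Fin N ⊕ Unit → ℝ) × (Fin M ⊕ Unit → ℝ))).IsAddHaarMeasure :=
    isAddHaarMeasure_volume_prod
  refine ⟨conjFlow (blockEquiv N M) Φ, ?_, isBounded_range_conjFlow _ hb,
    isPoincareRecurrentOn_conjFlow _ hrec⟩
  rw [reducedField_eq_conj hpq.p_mem.2 hpq.q_mem.2 hrow hcol]
  exact isTrajectory_conjFlow _ hΦ

/-! ### Lifting trajectories of the reduced system -/

/-- This makes the solutions of the gradient-descent-ascent system unique; it is where the second
derivatives of `f` and `g` are needed. -/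
theorem locallyLipschitz_gdaField (hf : ∀ i, ContDiff ℝ 2 (f i)) (hg : ∀ j, ContDiff ℝ 2 (g j)) :
    LocallyLipschitz (gdaField f g U) := by
  have hf1 (i) : ContDiff ℝ 1 (f i) := (hf i).of_le one_le_two
  have hg1 (j) : ContDiff ℝ 1 (g j) := (hg j).of_le one_le_two
  have hf2 (i) : ContDiff ℝ 1 (gradient (f i)) :=
    contDiff_gradient (hf i) one_add_one_eq_two.le
  have hg2 (j) : ContDiff ℝ 1 (gradient (g j)) :=
    contDiff_gradient (hg j) one_add_one_eq_two.le
  have hx (i) : ContDiff ℝ 1 fun x : State n m => x.1 i :=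
    contDiff_pi.1 contDiff_fst i
  have hy (j) : ContDiff ℝ 1 fun x : State n m => x.2.1 j :=
    contDiff_pi.1 (contDiff_fst.comp contDiff_snd) j
  have h3 : ContDiff ℝ 1 fun x : State n m => x.2.2.1 :=
    contDiff_fst.comp (contDiff_snd.comp contDiff_snd)
  have h4 : ContDiff ℝ 1 fun x : State n m => x.2.2.2 :=
    contDiff_snd.comp (contDiff_snd.comp contDiff_snd)
  have hθ (i) : ContDiff ℝ 1 fun x => (gdaField f g U x).1 i :=
    ((ContDiff.sum fun j _ => contDiff_const.mul ((hg1 j).comp (hy j))).add h3).neg.smul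
      ((hf2 i).comp (hx i))
  have hφ (j) : ContDiff ℝ 1 fun x => (gdaField f g U x).2.1 j :=
    ((ContDiff.sum fun i _ => contDiff_const.mul ((hf1 i).comp (hx i))).add h4).smul
      ((hg2 j).comp (hy j))
  refine ContDiff.locallyLipschitz (𝕂 := ℝ) ?_
  exact (contDiff_pi.2 hθ).prodMk ((contDiff_pi.2 hφ).prodMk
    (((ContDiff.sum fun i _ => (hf1 i).comp (hx i)).sub contDiff_const).prodMk
      ((ContDiff.sum fun j _ => (hg1 j).comp (hy j)).sub contDiff_const).neg))

/-- The map from reduced states to states given by curves `γ_i` and `δ_j` parametrized by the new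
coordinates. -/
def liftState (γ : ∀ i, ℝ → EuclideanSpace ℝ (Fin (n i)))
    (δ : ∀ j, ℝ → EuclideanSpace ℝ (Fin (m j))) (y : Reduced N M) : State n m :=
  (fun i => γ i (y.1 i), fun j => δ j (y.2.1 j), y.2.2.1, y.2.2.2)

theorem contDiff_liftState {r : WithTop ℕ∞} {γ : ∀ i, ℝ → EuclideanSpace ℝ (Fin (n i))}
    {δ : ∀ j, ℝ → EuclideanSpace ℝ (Fin (m j))} (hγ : ∀ i, ContDiff ℝ r (γ i))
    (hδ : ∀ j, ContDiff ℝ r (δ j)) : ContDiff ℝ r (liftState γ δ) := by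
  unfold liftState
  refine .prodMk (contDiff_pi.2 fun i => ?_) (.prodMk (contDiff_pi.2 fun j => ?_) (.prodMk ?_ ?_))
  all_goals fun_prop

/-- Gradient ascent curves run through at the speed of the reduced system solve the
gradient-descent-ascent system. -/
theorem isTrajectory_liftState {γ : ∀ i, ℝ → EuclideanSpace ℝ (Fin (n i))}
    {δ : ∀ j, ℝ → EuclideanSpace ℝ (Fin (m j))}
    (hγ : ∀ i, IsTrajectory (gradient (f i)) (γ i))
    (hδ : ∀ j, IsTrajectory (gradient (g j)) (δ j))
    (hX : ∀ i a, reparamInv (f i) (x₀.1 i) (p i) a = f i (γ i a))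
    (hY : ∀ j b, reparamInv (g j) (x₀.2.1 j) (q j) b = g j (δ j b))
    {y : ℝ → Reduced N M} (hy : IsTrajectory (reducedField f g U p q x₀) y) :
    IsTrajectory (gdaField f g U) fun t => liftState γ δ (y t) := by
  intro t
  have h1 := (ContinuousLinearMap.fst ℝ (Fin N → ℝ) ((Fin M → ℝ) × ℝ × ℝ)).hasFDerivAt
    |>.comp_hasDerivAt t (hy t)
  have h2 := (ContinuousLinearMap.snd ℝ (Fin N → ℝ) ((Fin M → ℝ) × ℝ × ℝ)).hasFDerivAt
    |>.comp_hasDerivAt t (hy t)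
  have h3 := (ContinuousLinearMap.fst ℝ (Fin M → ℝ) (ℝ × ℝ)).hasFDerivAt.comp_hasDerivAt t h2
  have h4 := (ContinuousLinearMap.snd ℝ (Fin M → ℝ) (ℝ × ℝ)).hasFDerivAt.comp_hasDerivAt t h2
  have hθ := hasDerivAt_pi.2 fun i => (hγ i _).scomp t (hasDerivAt_pi.1 h1 i)
  have hφ := hasDerivAt_pi.2 fun j => (hδ j _).scomp t (hasDerivAt_pi.1 h3 j)
  refine (hθ.prodMk (hφ.prodMk h4)).congr_deriv ?_
  refine Prod.ext (funext fun i => ?_) (Prod.ext (funext fun j => ?_) (Prod.ext ?_ ?_)) <;>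
    simp [reducedField, gdaField, liftState, hX, hY]

theorem contDiffOn_reduction {r : WithTop ℕ∞} (hf : ∀ i, ContDiff ℝ r (f i))
    (hg : ∀ j, ContDiff ℝ r (g j))
    (hA : ∀ i, ContDiffOn ℝ r (reparam (f i) (x₀.1 i) (p i)) (attainable (f i) (x₀.1 i)))
    (hB : ∀ j, ContDiffOn ℝ r (reparam (g j) (x₀.2.1 j) (q j)) (attainable (g j) (x₀.2.1 j))) :
    ContDiffOn ℝ r (reduction f g p q x₀) {x | (∀ i, f i (x.1 i) ∈ attainable (f i) (x₀.1 i)) ∧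
      ∀ j, g j (x.2.1 j) ∈ attainable (g j) (x₀.2.1 j)} := by
  have hx (i) : ContDiff ℝ r fun x : State n m => x.1 i :=
    contDiff_pi.1 contDiff_fst i
  have hy (j) : ContDiff ℝ r fun x : State n m => x.2.1 j :=
    contDiff_pi.1 (contDiff_fst.comp contDiff_snd) j
  unfold reduction
  refine .prodMk (contDiffOn_pi.2 fun i => ?_) (.prodMk (contDiffOn_pi.2 fun j => ?_) ?_)
  · exact (hA i).comp (f := fun x : State n m => f i (x.1 i))
      ((hf i).comp (hx i)).contDiffOn fun x hx => hx.1 i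
  · exact (hB j).comp (f := fun x : State n m => g j (x.2.1 j))
      ((hg j).comp (hy j)).contDiffOn fun x hx => hx.2 j
  · exact (contDiff_snd.comp contDiff_snd).contDiffOn

theorem isOpen_setOf_mem_attainable (hf : ∀ i, Continuous (f i)) (hg : ∀ j, Continuous (g j))
    (hA : ∀ i, IsOpen (attainable (f i) (x₀.1 i)))
    (hB : ∀ j, IsOpen (attainable (g j) (x₀.2.1 j))) :
    IsOpen {x : State n m | (∀ i, f i (x.1 i) ∈ attainable (f i) (x₀.1 i)) ∧
      ∀ j, g j (x.2.1 j) ∈ attainable (g j) (x₀.2.1 j)} := by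
  rw [ofPred_and, ofPred_forall, ofPred_forall]
  refine (isOpen_iInter_of_finite fun i => ?_).inter (isOpen_iInter_of_finite fun j => ?_)
  · exact (hA i).preimage (f := fun x : State n m => f i (x.1 i)) (by fun_prop)
  · exact (hB j).preimage (f := fun x : State n m => g j (x.2.1 j)) (by fun_prop)

end Reduced

end HiddenGame

theorem mainTheorem3 {N M : ℕ} {n : Fin N → ℕ} {m : Fin M → ℕ} (r : ℕ∞) (hr : 2 ≤ r)
    (f : ∀ i, EuclideanSpace ℝ (Fin (n i)) → ℝ) (hf : ∀ i, ContDiff ℝ r (f i))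
    (g : ∀ j, EuclideanSpace ℝ (Fin (m j)) → ℝ) (hg : ∀ j, ContDiff ℝ r (g j))
    (U : Matrix (Fin N) (Fin M) ℝ) (p : Fin N → ℝ) (q : Fin M → ℝ)
    (hpq : HiddenGame.IsFullyMixedNash U p q)
    (x₀ : HiddenGame.State n m)
    (hθ : ∀ i, HiddenGame.GradientComplete (f i) (x₀.1 i))
    (hφ : ∀ j, HiddenGame.GradientComplete (g j) (x₀.2.1 j))
    (hsafe : HiddenGame.IsSafe f g p q x₀) :
    -- the changes of variables are diffeomorphisms of the attainable ranges onto the line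
    (∀ i, HiddenGame.IsDiffeoBetween r (HiddenGame.reparam (f i) (x₀.1 i) (p i))
      (HiddenGame.attainable (f i) (x₀.1 i)) Set.univ) ∧
    (∀ j, HiddenGame.IsDiffeoBetween r (HiddenGame.reparam (g j) (x₀.2.1 j) (q j))
      (HiddenGame.attainable (g j) (x₀.2.1 j)) Set.univ) ∧
    -- the reduced vector field is regular and divergence free
    ContDiff ℝ r (HiddenGame.reducedField f g U p q x₀) ∧
    (∀ y, HiddenGame.divergence (HiddenGame.reducedField f g U p q x₀) y = 0) ∧
    -- it generates a flow with bounded orbits that is Poincaré recurrent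
    ∃ Ψ : Flow ℝ (HiddenGame.Reduced N M),
      (∀ y, HiddenGame.IsTrajectory (HiddenGame.reducedField f g U p q x₀) (fun t => Ψ t y)) ∧
      (∀ y, Bornology.IsBounded (Set.range fun t => Ψ t y)) ∧
      HiddenGame.IsPoincareRecurrentOn Ψ Set.univ ∧
      -- the trajectory from `x₀` exists, is unique, and is diffeomorphic to a trajectory of `Ψ`
      ∃ z : ℝ → HiddenGame.State n m,
        (z 0 = x₀ ∧ HiddenGame.IsTrajectory (HiddenGame.gdaField f g U) z) ∧
        (∀ w : ℝ → HiddenGame.State n m,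
          w 0 = x₀ → HiddenGame.IsTrajectory (HiddenGame.gdaField f g U) w → w = z) ∧
        (∀ t, HiddenGame.reduction f g p q x₀ (z t) =
          Ψ t (HiddenGame.reduction f g p q x₀ x₀)) ∧
        HiddenGame.IsDiffeoBetween r (HiddenGame.reduction f g p q x₀) (Set.range z)
          (Set.range fun t => Ψ t (HiddenGame.reduction f g p q x₀ x₀)) := by
  have hr' : (2 : WithTop ℕ∞) ≤ (r : WithTop ℕ∞) := WithTop.coe_le_coe.2 hr
  have hr1 : (1 : WithTop ℕ∞) ≤ (r : WithTop ℕ∞) := one_le_two.trans hr'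
  choose γ a₀ hγr hγ hγx hγp hγm hAatt hAopen hAr hA hX using fun i =>
    HiddenGame.exists_gradientCurve hr (hf i) (hθ i) (hsafe.θ_nonstationary i)
      (hsafe.p_attainable i)
  choose δ b₀ hδr hδ hδx hδq hδm hBatt hBopen hBr hB hY using fun j =>
    HiddenGame.exists_gradientCurve hr (hg j) (hφ j) (hsafe.φ_nonstationary j)
      (hsafe.q_attainable j)
  have hX' (i) : HiddenGame.reparamInv (f i) (x₀.1 i) (p i) = fun a => f i (γ i a) :=
    funext (hX i)
  have hY' (j) : HiddenGame.reparamInv (g j) (x₀.2.1 j) (q j) = fun b => g j (δ j b) :=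
    funext (hY j)
  have hXr (i) : ContDiff ℝ r (HiddenGame.reparamInv (f i) (x₀.1 i) (p i)) := by
    rw [hX']; exact (hf i).comp (hγr i)
  have hYr (j) : ContDiff ℝ r (HiddenGame.reparamInv (g j) (x₀.2.1 j) (q j)) := by
    rw [hY']; exact (hg j).comp (hδr j)
  obtain ⟨Ψ, hΨ, hbd, hrec⟩ := HiddenGame.exists_flow_reducedField hpq
    (fun i => (hXr i).of_le hr1) (fun j => (hYr j).of_le hr1)
    (fun i => by rw [hX']; exact hγm i) (fun j => by rw [hY']; exact hδm j)
    (fun i => by rw [hX, hγp]) (fun j => by rw [hY, hδq])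
  set y₀ := HiddenGame.reduction f g p q x₀ x₀
  -- `liftState γ δ` is a right inverse of the reduction, and maps `y₀` back to `x₀`.
  have hright (y : HiddenGame.Reduced N M) :
      HiddenGame.reduction f g p q x₀ (HiddenGame.liftState γ δ y) = y := by
    simp [HiddenGame.reduction, HiddenGame.liftState, hA, hB]
  have hx₀ : HiddenGame.liftState γ δ y₀ = x₀ := by
    have hx : x₀ = HiddenGame.liftState γ δ (a₀, b₀, x₀.2.2) := by
      simp [HiddenGame.liftState, hγx, hδx]
    have hy : y₀ = (a₀, b₀, x₀.2.2) :=
      (congrArg (HiddenGame.reduction f g p q x₀) hx).trans (hright _)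
    rw [hy, ← hx]
  have hz : HiddenGame.IsTrajectory (HiddenGame.gdaField f g U)
      fun t => HiddenGame.liftState γ δ (Ψ t y₀) :=
    HiddenGame.isTrajectory_liftState hγ hδ hX hY (hΨ y₀)
  refine ⟨fun i => HiddenGame.isDiffeoBetween_reparam ((hf i).comp (hγr i)) (hAatt i) (hAopen i)
      (hAr i) (hA i),
    fun j => HiddenGame.isDiffeoBetween_reparam ((hg j).comp (hδr j)) (hBatt j) (hBopen j)
      (hBr j) (hB j),
    HiddenGame.contDiff_reducedField hXr hYr,
    HiddenGame.divergence_reducedField hpq (fun i => (hXr i).of_le hr1)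
      (fun j => (hYr j).of_le hr1),
    Ψ, hΨ, hbd, hrec, fun t => HiddenGame.liftState γ δ (Ψ t y₀), ⟨?_, hz⟩, fun w hw0 hw => ?_,
    fun t => hright _, ?_, ⟨_, ?_, ?_, HiddenGame.contDiffOn_reduction hf hg hAr hBr⟩,
    HiddenGame.liftState γ δ, ?_, ⟨?_, fun y _ => hright y⟩, Set.univ, isOpen_univ,
    Set.subset_univ _, (HiddenGame.contDiff_liftState hγr hδr).contDiffOn⟩
  · simpa using hx₀
  · have hlip := HiddenGame.locallyLipschitz_gdaField (U := U) (fun i => (hf i).of_le hr')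
      (fun j => (hg j).of_le hr')
    exact HiddenGame.IsTrajectory.eq_of_apply_eq hlip hw hz (t₀ := 0) (by simp [hw0, hx₀])
  · rintro _ ⟨t, rfl⟩
    exact ⟨t, (hright _).symm⟩
  · exact HiddenGame.isOpen_setOf_mem_attainable (fun i => (hf i).continuous)
      (fun j => (hg j).continuous) hAopen hBopen
  · rintro _ ⟨t, rfl⟩
    exact ⟨fun i => (hAatt i).symm.subset ⟨_, rfl⟩, fun j => (hBatt j).symm.subset ⟨_, rfl⟩⟩
  · rintro _ ⟨t, rfl⟩
    exact ⟨t, rfl⟩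
  · rintro _ ⟨t, rfl⟩
    rw [hright]
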